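/- **Setting.** Let $(M,\omega)$ be a symplectic manifold (smooth, Hausdorff, $\sigma$-compact) with a pre-quantum line bundle $\mathcal L\to M$, i.e. a Hermitian line bundle with a unitary connection $\nabla$ of curvature $-i\omega$. Let $T$ be a complex manifold and $J=(J_\sigma)_{\sigma\in T}$ a smooth family of (almost) complex structures on $M$ compatible with $\omega$, so that $g_\sigma(u,v)=\omega(u,J_\sigma v)$ is a Riemannian metric, with inverse $\tilde g_\sigma$ and Levi-Civita connection, which is used to extend $\nabla$. Let $F$ be a smooth real function on $M\times T$ and $\lambda\in\mathbb R$ (in the original setting $J$ is an integrable, holomorphic and rigid family and $F$ a Ricci potential, $2i\partial\bar\partial F=\rho-\lambda\omega$; these properties are not needed). Fix an integer $k>0$. For a tangent vector $V$ at $\sigma\in T$ put $\tilde G(V)=-V[\tilde g]$, $G(V)=(\pi\otimes\pi)\tilde G(V)$ with $\pi=\tfrac12(1-iJ_\sigma)$, and $\overline G(V)=\overline{G(V)}$. Let $V'=\tfrac12(V-i\,(iV))$ and $V''=\tfrac12(V+i\,(iV))$ be the parts of $V$ of type $(1,0)$ and $(0,1)$. For a bivector field $B$ put $\Delta_B\psi=\operatorname{tr}\nabla(B\cdot\nabla\psi)=\nabla^2_B\psi+\nabla_{\delta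 B}\psi$. On smooth sections of $\mathcal L^k$ define $$b(V)=\Delta_{G(V)}+2\nabla_{G(V)\cdot dF}-2\lambda V'[F],\qquad \bar b(V)=\Delta_{\overline G(V)}+2\nabla_{\overline G(V)\cdot dF}-2\lambda V''[F].$$ For a family $D=(D_\sigma)$ of finite-order differential operators on sections of $\mathcal L^k$ depending smoothly on $\sigma$ put $\nabla^F_VD=V[D]+[V[F],D]$. For $t=k+is$ with $s$ real, the Hitchin–Witten covariant derivative of $D$ is $$\tilde E_VD=\nabla^F_VD+\tfrac1{2t}[b(V),D]-\tfrac1{2\bar t}[\bar b(V),D],$$ and the formal Hitchin–Witten connection is $\nabla^F+\sum_{l\ge1}s^{-l}\tilde D^{(l)}$ with $$\tilde D^{(l)}_V(D)=-\tfrac{(ik)^l}{2k}\,[\,b(V)-(-1)^l\,\bar b(V),D\,].$$ A formal series $\sum_{l\ge0}S^{(l)}s^{-l}$ is covariantly constant for it if, for every $\sigma\in T$, every $V\in T_\sigma T$ and every $l\ge0$, $$\nabla^F_VS^{(l)}+\sum_{m=1}^{l}\tilde D^{(m)}_V(S^{(l-m)})=0 .$$ **Statement.** Let $S^{(0)},S^{(1)},\dots$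 be families of finite-order differential operators on sections of $\mathcal L^k$ depending smoothly on $\sigma\in T$. Consider the asymptotic requirement $$(*)\qquad \tilde E_V\Bigl(\sum_{l=0}^{L}S^{(l)}s^{-l}\Bigr)=o(s^{-L})\quad\text{as } s\to\infty$$ for every $\sigma$, every $V\in T_\sigma T$ and every positive integer $L$ ($s\to+\infty$, $s\to-\infty$, $|s|\to\infty$, or along any filter with $|s|\to\infty$). 1. With $o(s^{-L})$ understood in the sense of strong $L^2$ convergence, i.e. $|s|^{L}\,\|A(s)\psi\|_{L^2}\to0$ for every compactly supported smooth section $\psi$ of $\mathcal L^k$ (every smooth section, if $M$ is compact; the $L^2$ norm is that of the Hermitian structure and the Liouville measure), the requirement $(*)$ holds if and only if $\sum_l S^{(l)}s^{-l}$ is covariantly constant for the formal Hitchin–Witten connection. 2. The same holds with $o(s^{-L})$ measured by any norm on operators, and more generally by any family $(p_{j,\sigma})_j$ of $[0,\infty]$-valued seminorms on the linear operators on smooth sections of $\mathcal L^k$ (possibly depending on $\sigma$) which separates operators, provided that all $p_{j,\sigma}$ are finite on the operators $\nabla^F_VS^{(l)}$, $[b(V),S^{(l)}]$ and $[\bar b(V),S^{(l)}]$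 at $\sigma$: the requirement $(*)$ holds for all $p_{j,\sigma}$ if and only if the series is covariantly constant for the formal Hitchin–Witten connection. -/

import Mathlib

open scoped Manifold ContDiff Bundle Topology
open Bundle Set

set_option linter.unusedSectionVars false

/-- The model space of an `n`-dimensional manifold. -/
abbrev Rn (n : ℕ) : Type := EuclideanSpace ℝ (Fin n)

section Frames

variable {n : ℕ} {M : Type*} [TopologicalSpace M] [ChartedSpace (Rn n) M]
  [IsManifold (𝓡 n) ∞ M]

/-- The coordinate frame of the chart at `x₀`, evaluated at `x`. -/
noncomputable def frameAt (x₀ x : M) : Rn n →L[ℝ] TangentSpace (𝓡 n) x :=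
  (trivializationAt (Rn n) (TangentSpace (𝓡 n)) x₀).symmL ℝ x

/-- Components of tangent vectors at `x` with respect to the chart at `x₀`. -/
noncomputable def coframeAt (x₀ x : M) : TangentSpace (𝓡 n) x →L[ℝ] Rn n :=
  (trivializationAt (Rn n) (TangentSpace (𝓡 n)) x₀).continuousLinearMapAt ℝ x

theorem mem_base_iff {x₀ x : M} : x ∈ (trivializationAt (Rn n) (TangentSpace (𝓡 n)) x₀).baseSet ↔
    x ∈ (chartAt (Rn n) x₀).source := Iff.rfl

theorem coframe_frame {x₀ x : M} (h : x ∈ (chartAt (Rn n) x₀).source) (v : Rn n) :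
    coframeAt x₀ x (frameAt x₀ x v) = v :=
  (trivializationAt (Rn n) (TangentSpace (𝓡 n)) x₀).continuousLinearMapAt_symmL
    (mem_base_iff.2 h) v

theorem frame_coframe {x₀ x : M} (h : x ∈ (chartAt (Rn n) x₀).source)
    (v : TangentSpace (𝓡 n) x) : frameAt x₀ x (coframeAt x₀ x v) = v :=
  (trivializationAt (Rn n) (TangentSpace (𝓡 n)) x₀).symmL_continuousLinearMapAt
    (mem_base_iff.2 h) v

theorem chart_mem_nhds (x₀ : M) : ∀ᶠ x in 𝓝 x₀, x ∈ (chartAt (Rn n) x₀).source :=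
  chart_source_mem_nhds _ x₀

/-- A vector field is smooth at `x₀`. -/
def VFSmoothAt (X : ∀ x : M, TangentSpace (𝓡 n) x) (x₀ : M) : Prop :=
  ContMDiffAt (𝓡 n) (𝓡 n).tangent ∞ (fun x => (⟨x, X x⟩ : TangentBundle (𝓡 n) M)) x₀

/-- A 1-form with values in `W` is smooth at `x₀`: its components are. -/
def CovSmoothAt {W : Type*} [NormedAddCommGroup W] [NormedSpace ℝ W]
    (α : ∀ x : M, TangentSpace (𝓡 n) x →L[ℝ] W) (x₀ : M) : Prop :=
  ContMDiffAt (𝓡 n) 𝓘(ℝ, Rn n →L[ℝ] W) ∞ (fun x => α x ∘L frameAt x₀ x) x₀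

theorem vfSmoothAt_iff (X : ∀ x : M, TangentSpace (𝓡 n) x) (x₀ : M) :
    VFSmoothAt X x₀ ↔ ContMDiffAt (𝓡 n) 𝓘(ℝ, Rn n) ∞ (fun x => coframeAt x₀ x (X x)) x₀ := by
  unfold VFSmoothAt
  erw [Bundle.contMDiffAt_section]
  apply Filter.EventuallyEq.contMDiffAt_iff
  filter_upwards [chart_mem_nhds (n := n) x₀] with x hx
  unfold coframeAt
  rw [Trivialization.continuousLinearMapAt_apply, Trivialization.linearMapAt_apply, if_pos]
  exact hx

theorem covSmoothAt_apply {W : Type*} [NormedAddCommGroup W] [NormedSpace ℝ W]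
    {α : ∀ x : M, TangentSpace (𝓡 n) x →L[ℝ] W} {X : ∀ x : M, TangentSpace (𝓡 n) x} {x₀ : M}
    (hα : CovSmoothAt α x₀) (hX : VFSmoothAt X x₀) :
    ContMDiffAt (𝓡 n) 𝓘(ℝ, W) ∞ (fun x => α x (X x)) x₀ := by
  have h := ContMDiffAt.clm_apply hα ((vfSmoothAt_iff X x₀).1 hX)
  refine h.congr_of_eventuallyEq ?_
  filter_upwards [chart_mem_nhds (n := n) x₀] with x hx
  simp [frame_coframe hx]

theorem covSmoothAt_mvfderiv {W : Type*} [NormedAddCommGroup W] [NormedSpace ℝ W]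
    {f : M → W} {x₀ : M} (hf : ContMDiffAt (𝓡 n) 𝓘(ℝ, W) ∞ f x₀) :
    CovSmoothAt (fun x => mvfderiv (𝓡 n) f x) x₀ := by
  have h := ContMDiffAt.mfderiv_const (m := ∞) hf (by simp)
  unfold CovSmoothAt
  refine h.congr_of_eventuallyEq ?_
  filter_upwards [chart_mem_nhds (n := n) x₀] with x hx
  ext v
  simp [inTangentCoordinates, ContinuousLinearMap.inCoordinates, mvfderiv, frameAt]
  rfl

theorem partial_smoothAt {ET T W : Type*} [NormedAddCommGroup ET] [NormedSpace ℝ ET]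
    [TopologicalSpace T] [ChartedSpace ET T] [IsManifold 𝓘(ℝ, ET) ∞ T]
    [NormedAddCommGroup W] [NormedSpace ℝ W] {f : M → T → W} {x₀ : M} {σ : T}
    (hf : ContMDiffAt ((𝓡 n).prod 𝓘(ℝ, ET)) 𝓘(ℝ, W) ∞ (fun p : M × T => f p.1 p.2) (x₀, σ))
    (V : TangentSpace 𝓘(ℝ, ET) σ) :
    ContMDiffAt (𝓡 n) 𝓘(ℝ, W) ∞ (fun x => mvfderiv 𝓘(ℝ, ET) (f x) σ V) x₀ := by
  have h := ContMDiffAt.mfderiv (m := ∞) (x₀ := x₀) f (fun _ => σ) hf contMDiffAt_const (by simp)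
  let v : ET := V
  have h2 := ContMDiffAt.clm_apply h (contMDiffAt_const (c := v))
  refine h2.congr_of_eventuallyEq ?_
  filter_upwards with x
  have hc : (trivializationAt ET (TangentSpace 𝓘(ℝ, ET) : T → Type _) σ).symmL ℝ σ V = V := by
    rw [TangentBundle.symmL_trivializationAt_eq_core (mem_chart_source ET σ)]
    exact (tangentBundleCore 𝓘(ℝ, ET) T).coordChange_self (achart ET σ) σ (mem_chart_source ET σ) V
  simp only [inTangentCoordinates, ContinuousLinearMap.inCoordinates, mvfderiv]
  simp only [trivializationAt_model_space_apply, TangentBundle.continuousLinearMapAt_model_space]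
  exact congrArg (fun v => mfderiv 𝓘(ℝ, ET) 𝓘(ℝ, W) (f x) σ v) hc.symm
end Frames

section Geometry
variable {n : ℕ} {M : Type*} [TopologicalSpace M] [ChartedSpace (Rn n) M]
  [IsManifold (𝓡 n) ∞ M]

variable (n M) in
/-- A symplectic form on `M`. -/
structure SymplecticForm where
  form : ∀ x : M, TangentSpace (𝓡 n) x →L[ℝ] TangentSpace (𝓡 n) x →L[ℝ] ℝ
  smooth : ∀ x₀ : M, ContMDiffAt (𝓡 n) 𝓘(ℝ, Rn n →L[ℝ] Rn n →L[ℝ] ℝ) ∞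
    (fun x => ((frameAt x₀ x).precomp ℝ) ∘L (form x) ∘L frameAt x₀ x) x₀
  skew : ∀ x u v, form x u v = - form x v u
  nondegenerate : ∀ x u, (∀ v, form x u v = 0) → u = 0
  closed : ∀ X Y Z : ∀ x : M, TangentSpace (𝓡 n) x,
    (∀ x, VFSmoothAt X x) → (∀ x, VFSmoothAt Y x) → (∀ x, VFSmoothAt Z x) → ∀ x : M,
    mvfderiv (𝓡 n) (fun y => form y (Y y) (Z y)) x (X x)
      + mvfderiv (𝓡 n) (fun y => form y (Z y) (X y)) x (Y x)
      + mvfderiv (𝓡 n) (fun y => form y (X y) (Y y)) x (Z x)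
      - form x (VectorField.mlieBracket (𝓡 n) X Y x) (Z x)
      - form x (VectorField.mlieBracket (𝓡 n) Y Z x) (X x)
      - form x (VectorField.mlieBracket (𝓡 n) Z X x) (Y x) = 0

namespace SymplecticForm
variable (Ω : SymplecticForm n M)

theorem isInvertible (x : M) : (Ω.form x).IsInvertible := by
  have hinj : Function.Injective (Ω.form x) := by
    rw [injective_iff_map_eq_zero]
    exact fun u hu => Ω.nondegenerate x u fun v => by rw [hu]; rfl
  let f : Rn n →L[ℝ] (Rn n →L[ℝ] ℝ) := Ω.form x
  have hinj' : Function.Injective (f : Rn n →ₗ[ℝ] (Rn n →L[ℝ] ℝ)) := hinj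
  have hd : Module.finrank ℝ (Rn n) = Module.finrank ℝ (Rn n →L[ℝ] ℝ) := by
    rw [← (LinearMap.toContinuousLinearMap (𝕜 := ℝ) (E := Rn n) (F' := ℝ)).finrank_eq]
    exact (Subspace.dual_finrank_eq).symm
  let e := (LinearEquiv.ofInjectiveOfFinrankEq (f : Rn n →ₗ[ℝ] (Rn n →L[ℝ] ℝ)) hinj' hd)
  exact ⟨e.toContinuousLinearEquiv, by ext; rfl⟩

/-- The Poisson bivector `ω♯ : T*M → TM`, inverse to `u ↦ ω(u, ·)`. -/
noncomputable def sharp (x : M) :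
    (TangentSpace (𝓡 n) x →L[ℝ] ℝ) →L[ℝ] TangentSpace (𝓡 n) x :=
  (Ω.form x).inverse

theorem form_sharp (x : M) (α : TangentSpace (𝓡 n) x →L[ℝ] ℝ) : Ω.form x (Ω.sharp x α) = α :=
  (Ω.isInvertible x).self_apply_inverse α

theorem sharp_smoothAt {α : ∀ x : M, TangentSpace (𝓡 n) x →L[ℝ] ℝ} {x₀ : M}
    (hα : CovSmoothAt α x₀) : VFSmoothAt (fun x => Ω.sharp x (α x)) x₀ := by
  rw [vfSmoothAt_iff]
  let c : M → (Rn n →L[ℝ] Rn n →L[ℝ] ℝ) := fun x =>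
    ((frameAt x₀ x).precomp ℝ) ∘L (Ω.form x) ∘L frameAt x₀ x
  have hc : ∀ x ∈ (chartAt (Rn n) x₀).source, (c x).IsInvertible := by
    intro x hx
    have hinj : Function.Injective (c x : Rn n →ₗ[ℝ] Rn n →L[ℝ] ℝ) := by
      rw [injective_iff_map_eq_zero]
      intro u hu
      have : frameAt x₀ x u = 0 := Ω.nondegenerate x _ fun v => by
        have := DFunLike.congr_fun hu (coframeAt x₀ x v)
        simpa [c, frame_coframe hx] using this
      simpa [coframe_frame hx] using congrArg (coframeAt x₀ x) this
    have hd : Module.finrank ℝ (Rn n) = Module.finrank ℝ (Rn n →L[ℝ] ℝ) := by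
      rw [← (LinearMap.toContinuousLinearMap (𝕜 := ℝ) (E := Rn n) (F' := ℝ)).finrank_eq]
      exact (Subspace.dual_finrank_eq).symm
    exact ⟨(LinearEquiv.ofInjectiveOfFinrankEq _ hinj hd).toContinuousLinearEquiv, by ext; rfl⟩
  have hi : ContMDiffAt (𝓡 n) 𝓘(ℝ, (Rn n →L[ℝ] ℝ) →L[ℝ] Rn n) ∞
      (fun x => (c x).inverse) x₀ :=
    (((hc x₀ (mem_chart_source _ x₀)).contDiffAt_map_inverse (n := ∞)).contMDiffAt).comp x₀
      (Ω.smooth x₀)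
  refine (hi.clm_apply hα).congr_of_eventuallyEq ?_
  filter_upwards [chart_mem_nhds (n := n) x₀] with x hx
  symm
  rw [(hc x hx).inverse_apply_eq]
  ext v
  simp [c, frame_coframe hx, form_sharp]
end SymplecticForm
end Geometry

section Geometry
variable {n : ℕ} {M : Type*} [TopologicalSpace M] [ChartedSpace (Rn n) M]
  [IsManifold (𝓡 n) ∞ M]

theorem cmul_smoothAt {E H N : Type*} [NormedAddCommGroup E] [NormedSpace ℝ E]
    [TopologicalSpace H] {J : ModelWithCorners ℝ E H} [TopologicalSpace N] [ChartedSpace H N]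
    {f g : N → ℂ} {x : N}
    (hf : ContMDiffAt J 𝓘(ℝ, ℂ) ∞ f x) (hg : ContMDiffAt J 𝓘(ℝ, ℂ) ∞ g x) :
    ContMDiffAt J 𝓘(ℝ, ℂ) ∞ (fun y => f y * g y) x :=
  ContMDiffAt.clm_apply (g := fun y => ContinuousLinearMap.mul ℝ ℂ (f y))
    ((ContinuousLinearMap.mul ℝ ℂ).contMDiff.contMDiffAt.comp x hf) hg

theorem cpow_smoothAt {f : M → ℂ} {x : M} (hf : ContMDiffAt (𝓡 n) 𝓘(ℝ, ℂ) ∞ f x) (k : ℕ) :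
    ContMDiffAt (𝓡 n) 𝓘(ℝ, ℂ) ∞ (fun y => f y ^ k) x := by
  induction k with
  | zero => simpa using contMDiffAt_const
  | succ k ih => simpa only [pow_succ] using cmul_smoothAt ih hf

theorem mvfderiv_cmul {f g : M → ℂ} {x : M} (hf : MDifferentiableAt (𝓡 n) 𝓘(ℝ, ℂ) f x)
    (hg : MDifferentiableAt (𝓡 n) 𝓘(ℝ, ℂ) g x) (v : TangentSpace (𝓡 n) x) :
    mvfderiv (𝓡 n) (fun y => f y * g y) x v
      = f x * mvfderiv (𝓡 n) g x v + g x * mvfderiv (𝓡 n) f x v := by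
  have h := (hf.hasMFDerivAt.mul hg.hasMFDerivAt).mfderiv
  have h2 : mfderiv (𝓡 n) 𝓘(ℝ, ℂ) (fun y => f y * g y) x = _ := h
  simp only [mvfderiv, h2]
  rfl

theorem mvfderiv_congr {W : Type*} [NormedAddCommGroup W] [NormedSpace ℝ W]
    {f g : M → W} {x : M} (h : f =ᶠ[𝓝 x] g) :
    mvfderiv (𝓡 n) f x = mvfderiv (𝓡 n) g x := by
  ext v
  have := h.mfderiv_eq (I := 𝓡 n) (I' := 𝓘(ℝ, W))
  exact DFunLike.congr_fun this v

theorem mvfderiv_clm_comp {E N W W' : Type*} [NormedAddCommGroup E] [NormedSpace ℝ E]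
    [TopologicalSpace N] [ChartedSpace E N] [NormedAddCommGroup W] [NormedSpace ℝ W]
    [NormedAddCommGroup W'] [NormedSpace ℝ W'] (A : W →L[ℝ] W')
    {f : N → W} {x : N} (h : MDifferentiableAt 𝓘(ℝ, E) 𝓘(ℝ, W) f x)
    (v : TangentSpace 𝓘(ℝ, E) x) :
    mvfderiv 𝓘(ℝ, E) (fun y => A (f y)) x v = A (mvfderiv 𝓘(ℝ, E) f x v) := by
  have := (A.hasMFDerivAt.comp x h.hasMFDerivAt).mfderiv
  have h2 : mfderiv 𝓘(ℝ, E) 𝓘(ℝ, W') (fun y => A (f y)) x = _ := this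
  simp only [mvfderiv, h2]
  rfl

/-- A Hermitian line bundle with unitary connection of curvature `-iω`, in terms of an open cover
by local unitary frames: sections satisfy `ψ_i = g_{ij} ψ_j`, and `∇ = d - i θ_i` in the `i`-th
frame. As in Mathlib's `VectorBundleCore`, `indexAt x` selects the frame used for the fibre
at `x`. -/
structure PrequantumBundle (ι : Type*) (Ω : SymplecticForm n M) where
  U : ι → Set M
  isOpen_U : ∀ i, IsOpen (U i)
  indexAt : M → ι
  mem_indexAt : ∀ x, x ∈ U (indexAt x)
  tr : ι → ι → M → ℂ
  tr_smooth : ∀ i j x, x ∈ U i → x ∈ U j → ContMDiffAt (𝓡 n) 𝓘(ℝ, ℂ) ∞ (tr i j) x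
  norm_tr : ∀ i j x, x ∈ U i → x ∈ U j → ‖tr i j x‖ = 1
  tr_self : ∀ i x, x ∈ U i → tr i i x = 1
  tr_mul : ∀ i j l x, x ∈ U i → x ∈ U j → x ∈ U l → tr i j x * tr j l x = tr i l x
  θ : ι → ∀ x : M, TangentSpace (𝓡 n) x →L[ℝ] ℝ
  θ_smooth : ∀ i x, x ∈ U i → CovSmoothAt (θ i) x
  tr_deriv : ∀ i j x, x ∈ U i → x ∈ U j → ∀ v : TangentSpace (𝓡 n) x,
    mvfderiv (𝓡 n) (tr i j) x v = Complex.I * ((θ i x v : ℂ) - θ j x v) * tr i j x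
  curvature : ∀ i, ∀ X Y : ∀ x : M, TangentSpace (𝓡 n) x,
    (∀ x, VFSmoothAt X x) → (∀ x, VFSmoothAt Y x) → ∀ x ∈ U i,
    mvfderiv (𝓡 n) (fun y => θ i y (Y y)) x (X x) - mvfderiv (𝓡 n) (fun y => θ i y (X y)) x (Y x)
      - θ i x (VectorField.mlieBracket (𝓡 n) X Y x) = Ω.form x (X x) (Y x)

namespace PrequantumBundle
variable {ι : Type*} {Ω : SymplecticForm n M} (L : PrequantumBundle ι Ω) (k : ℕ)

/-- The representative, in the `i`-th frame, of a section of the `k`-th tensor power. -/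
def rep (i : ι) (ψ : M → ℂ) (x : M) : ℂ := L.tr i (L.indexAt x) x ^ k * ψ x

theorem rep_indexAt (ψ : M → ℂ) (x : M) : L.rep k (L.indexAt x) ψ x = ψ x := by
  simp [rep, L.tr_self _ _ (L.mem_indexAt x)]

theorem rep_gauge {i j : ι} {x : M} (hi : x ∈ L.U i) (hj : x ∈ L.U j) (ψ : M → ℂ) :
    L.rep k i ψ x = L.tr i j x ^ k * L.rep k j ψ x := by
  simp only [rep]
  rw [← L.tr_mul i j _ x hi hj (L.mem_indexAt x)]
  ring

/-- Smooth sections of the `k`-th tensor power of the prequantum bundle. -/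
def Sec : Submodule ℂ (M → ℂ) where
  carrier := {ψ | ∀ i, ∀ x ∈ L.U i, ContMDiffAt (𝓡 n) 𝓘(ℝ, ℂ) ∞ (L.rep k i ψ) x}
  zero_mem' i x _ := by
    have : L.rep k i 0 = fun _ => 0 := by funext y; simp [rep]
    rw [this]; exact contMDiffAt_const
  add_mem' {a b} ha hb i x hx := by
    have : L.rep k i (a + b) = L.rep k i a + L.rep k i b := by
      funext y; simp [rep, mul_add]
    rw [this]; exact (ha i x hx).add (hb i x hx)
  smul_mem' c a ha i x hx := by
    have : L.rep k i (c • a) = fun y => c * L.rep k i a y := by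
      funext y; simp [rep]; ring
    rw [this]; exact cmul_smoothAt contMDiffAt_const (ha i x hx)

theorem nhds_U {i : ι} {x : M} (hi : x ∈ L.U i) : ∀ᶠ y in 𝓝 x, y ∈ L.U i :=
  (L.isOpen_U i).mem_nhds hi

/-- To check smoothness of a section at `x`, one frame is enough. -/
theorem smooth_of_one {ψ : M → ℂ}
    (h : ∀ x, ∃ i, x ∈ L.U i ∧ ContMDiffAt (𝓡 n) 𝓘(ℝ, ℂ) ∞ (L.rep k i ψ) x) :
    ψ ∈ L.Sec k := by
  intro j x hj
  obtain ⟨i, hi, hs⟩ := h x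
  refine (cmul_smoothAt (cpow_smoothAt (L.tr_smooth j i x hj hi) k) hs).congr_of_eventuallyEq ?_
  filter_upwards [L.nhds_U hi, L.nhds_U hj] with y hy hy'
  exact L.rep_gauge k hy' hy ψ

/-- The covariant derivative in the `i`-th frame: `∇ f = df - i k θ_i f`. -/
noncomputable def covD (i : ι) (f : M → ℂ) (x : M) : TangentSpace (𝓡 n) x →L[ℝ] ℂ :=
  mvfderiv (𝓡 n) f x - (L.θ i x).smulRight (Complex.I * k * f x)

theorem covD_congr {i : ι} {f g : M → ℂ} {x : M} (h : f =ᶠ[𝓝 x] g) :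
    L.covD k i f x = L.covD k i g x := by
  simp only [covD, mvfderiv_congr h, h.self_of_nhds]

theorem mvfderiv_tr_pow {i j : ι} {x : M} (hi : x ∈ L.U i) (hj : x ∈ L.U j)
    (v : TangentSpace (𝓡 n) x) :
    mvfderiv (𝓡 n) (fun y => L.tr i j y ^ k) x v
      = k * (Complex.I * ((L.θ i x v : ℂ) - L.θ j x v)) * L.tr i j x ^ k := by
  induction k with
  | zero => simp [mvfderiv_const]
  | succ k ih =>
    simp only [pow_succ]
    rw [mvfderiv_cmul ((cpow_smoothAt (L.tr_smooth i j x hi hj) k).mdifferentiableAt (by simp))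
      ((L.tr_smooth i j x hi hj).mdifferentiableAt (by simp)), ih, L.tr_deriv i j x hi hj]
    push_cast
    ring

theorem covD_gauge {i j : ι} {x : M} (hi : x ∈ L.U i) (hj : x ∈ L.U j) {f : M → ℂ}
    (hf : ContMDiffAt (𝓡 n) 𝓘(ℝ, ℂ) ∞ f x) :
    L.covD k i (fun y => L.tr i j y ^ k * f y) x = L.tr i j x ^ k • L.covD k j f x := by
  ext v
  simp only [covD, sub_apply, ContinuousLinearMap.smulRight_apply,
    smul_apply, smul_eq_mul, Complex.real_smul]
  rw [mvfderiv_cmul ((cpow_smoothAt (L.tr_smooth i j x hi hj) k).mdifferentiableAt (by simp))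
    (hf.mdifferentiableAt (by simp)), L.mvfderiv_tr_pow k hi hj]
  ring

theorem covD_smoothAt {i : ι} {x : M} (hi : x ∈ L.U i) {f : M → ℂ}
    (hf : ContMDiffAt (𝓡 n) 𝓘(ℝ, ℂ) ∞ f x) : CovSmoothAt (L.covD k i f) x := by
  have h1 := covSmoothAt_mvfderiv hf
  let sp : ℂ →L[ℝ] (ℝ →L[ℝ] ℂ) := LinearMap.toContinuousLinearMap
    { toFun := fun c => ContinuousLinearMap.toSpanSingleton ℝ c
      map_add' := fun a b => by ext; simp
      map_smul' := fun a b => by ext; simp }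
  have h2 : ContMDiffAt (𝓡 n) 𝓘(ℝ, Rn n →L[ℝ] ℂ) ∞
      (fun y => (sp (Complex.I * k * f y)) ∘L (L.θ i y ∘L frameAt x y)) x :=
    ContMDiffAt.clm_comp
      (sp.contMDiff.contMDiffAt.comp x (cmul_smoothAt contMDiffAt_const hf)) (L.θ_smooth i x hi)
  exact h1.sub h2

theorem covD_add {i : ι} {x : M} {f g : M → ℂ} (hf : ContMDiffAt (𝓡 n) 𝓘(ℝ, ℂ) ∞ f x)
    (hg : ContMDiffAt (𝓡 n) 𝓘(ℝ, ℂ) ∞ g x) :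
    L.covD k i (fun y => f y + g y) x = L.covD k i f x + L.covD k i g x := by
  ext v
  simp only [covD, sub_apply, ContinuousLinearMap.smulRight_apply,
    add_apply, Complex.real_smul]
  rw [mvfderiv_fun_add (hf.mdifferentiableAt (by simp)) (hg.mdifferentiableAt (by simp))]
  simp only [add_apply]
  ring

theorem covD_smul {i : ι} {x : M} (c : ℂ) {f : M → ℂ} (hf : ContMDiffAt (𝓡 n) 𝓘(ℝ, ℂ) ∞ f x) :
    L.covD k i (fun y => c * f y) x = c • L.covD k i f x := by
  ext v
  simp only [covD, sub_apply, ContinuousLinearMap.smulRight_apply,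
    smul_apply, smul_eq_mul, Complex.real_smul]
  rw [mvfderiv_cmul mdifferentiableAt_const (hf.mdifferentiableAt (by simp)), mvfderiv_const]
  simp only [zero_apply]
  ring
end PrequantumBundle
end Geometry

section Geometry
variable {n : ℕ} {M : Type*} [TopologicalSpace M] [ChartedSpace (Rn n) M]
  [IsManifold (𝓡 n) ∞ M]

/-- Smooth connections on the tangent bundle. -/
structure SmoothConnection (n : ℕ) (M : Type*) [TopologicalSpace M] [ChartedSpace (Rn n) M]
  [IsManifold (𝓡 n) ∞ M] extends
    CovariantDerivative (𝓡 n) (Rn n) (TangentSpace (𝓡 n) : M → Type _) where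
  smooth : ∀ u : Set M, IsOpen u → ContMDiffCovariantDerivativeOn (Rn n) ∞ toFun u

/-- The divergence of a vector field: the trace of `v ↦ ∇_v X`. -/
noncomputable def divergence
    (cov : (∀ x : M, TangentSpace (𝓡 n) x) →
      (∀ x : M, TangentSpace (𝓡 n) x →L[ℝ] TangentSpace (𝓡 n) x))
    (X : ∀ x : M, TangentSpace (𝓡 n) x) (x : M) : ℝ :=
  LinearMap.trace ℝ (TangentSpace (𝓡 n) x) (cov X x : TangentSpace (𝓡 n) x →ₗ[ℝ] _)

theorem VFSmoothAt.mdiff {X : ∀ x : M, TangentSpace (𝓡 n) x} {x : M} (h : VFSmoothAt X x) :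
    MDifferentiableAt (𝓡 n) ((𝓡 n).prod 𝓘(ℝ, Rn n))
      (fun x => (TotalSpace.mk' (Rn n) x (X x) : TotalSpace (Rn n) (TangentSpace (𝓡 n) : M → Type _))) x :=
  ContMDiffAt.mdifferentiableAt h (by simp)

theorem VFSmoothAt.add {X Y : ∀ x : M, TangentSpace (𝓡 n) x} {x : M} (h : VFSmoothAt X x)
    (h' : VFSmoothAt Y x) : VFSmoothAt (fun y => X y + Y y) x := by
  rw [vfSmoothAt_iff] at *
  simp only [map_add]
  exact h.add h'

theorem VFSmoothAt.smul {X : ∀ x : M, TangentSpace (𝓡 n) x} {f : M → ℝ} {x : M}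
    (hf : ContMDiffAt (𝓡 n) 𝓘(ℝ, ℝ) ∞ f x) (h : VFSmoothAt X x) :
    VFSmoothAt (fun y => f y • X y) x := by
  rw [vfSmoothAt_iff] at *
  simp only [map_smul]
  exact hf.smul h

namespace SmoothConnection
variable (D : SmoothConnection n M)

theorem isCov : IsCovariantDerivativeOn (Rn n) D.toFun :=
  D.isCovariantDerivativeOnUniv

theorem div_congr {X Y : ∀ x : M, TangentSpace (𝓡 n) x} {x : M} (hX : VFSmoothAt X x)
    (hY : VFSmoothAt Y x) (h : ∀ᶠ y in 𝓝 x, X y = Y y) :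
    divergence D.toFun X x = divergence D.toFun Y x := by
  unfold divergence
  rw [D.isCov.congr_of_eventuallyEq hX.mdiff hY.mdiff Filter.univ_mem h]

theorem div_add {X Y : ∀ x : M, TangentSpace (𝓡 n) x} {x : M} (hX : VFSmoothAt X x)
    (hY : VFSmoothAt Y x) :
    divergence D.toFun (fun y => X y + Y y) x
      = divergence D.toFun X x + divergence D.toFun Y x := by
  unfold divergence
  have := D.isCov.add hX.mdiff hY.mdiff
  have h2 : D.toFun (fun y => X y + Y y) x = _ := this
  rw [h2, ContinuousLinearMap.toLinearMap_add, map_add]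

theorem div_smul {X : ∀ x : M, TangentSpace (𝓡 n) x} {f : M → ℝ} {x : M}
    (hf : ContMDiffAt (𝓡 n) 𝓘(ℝ, ℝ) ∞ f x) (hX : VFSmoothAt X x) :
    divergence D.toFun (fun y => f y • X y) x
      = f x * divergence D.toFun X x + mvfderiv (𝓡 n) f x (X x) := by
  unfold divergence
  have := D.isCov.leibniz hX.mdiff (hf.mdifferentiableAt (by simp))
  have h2 : D.toFun (fun y => f y • X y) x = _ := this
  let d : Rn n →L[ℝ] ℝ := mvfderiv (𝓡 n) f x
  have h3 := LinearMap.trace_smulRight (R := ℝ) (M := Rn n) (d : Rn n →ₗ[ℝ] ℝ) (X x)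
  rw [h2, ContinuousLinearMap.toLinearMap_add, map_add, ContinuousLinearMap.toLinearMap_smul,
    map_smul, smul_eq_mul]
  congr 1

theorem div_smoothAt {X : ∀ x : M, TangentSpace (𝓡 n) x} {u : Set M} (hu : IsOpen u)
    (hX : ∀ x ∈ u, VFSmoothAt X x) {x : M} (hx : x ∈ u) :
    ContMDiffAt (𝓡 n) 𝓘(ℝ, ℝ) ∞ (divergence D.toFun X) x := by
  have h := (D.smooth u hu).contMDiff (σ := X) (fun y hy => (hX y hy).contMDiffWithinAt)
  have h1 := (contMDiffAt_hom_bundle _).1 ((h x hx).contMDiffAt (hu.mem_nhds hx))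
  let tr : (Rn n →L[ℝ] Rn n) →L[ℝ] ℝ := LinearMap.toContinuousLinearMap
    ((LinearMap.trace ℝ (Rn n)) ∘ₗ (ContinuousLinearMap.coeLM ℝ))
  refine (tr.contMDiff.contMDiffAt.comp x h1.2).congr_of_eventuallyEq ?_
  filter_upwards [chart_mem_nhds (n := n) x] with y hy
  let e : TangentSpace (𝓡 n) y ≃ₗ[ℝ] Rn n :=
    { toFun := coframeAt x y
      map_add' := map_add _
      map_smul' := map_smul _
      invFun := frameAt x y
      left_inv := frame_coframe hy
      right_inv := coframe_frame hy }
  exact (LinearMap.trace_conj' (D.toFun X y : TangentSpace (𝓡 n) y →ₗ[ℝ] _) e).symm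
end SmoothConnection
end Geometry

section Geometry
variable {n : ℕ} {M : Type*} [TopologicalSpace M] [ChartedSpace (Rn n) M]
  [IsManifold (𝓡 n) ∞ M]

theorem CovSmoothAt.clm_comp {W W' : Type*} [NormedAddCommGroup W] [NormedSpace ℝ W]
    [NormedAddCommGroup W'] [NormedSpace ℝ W'] (A : W →L[ℝ] W')
    {α : ∀ x : M, TangentSpace (𝓡 n) x →L[ℝ] W} {x : M} (h : CovSmoothAt α x) :
    CovSmoothAt (fun y => A ∘L α y) x :=
  ContMDiffAt.clm_comp (g := fun _ => A) contMDiffAt_const h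

/-- A (contravariant) tensor field `T*M → TM` is smooth if it takes smooth 1-forms to smooth
vector fields. -/
def BivSmooth (B : ∀ x : M, (TangentSpace (𝓡 n) x →L[ℝ] ℝ) →L[ℝ] TangentSpace (𝓡 n) x) : Prop :=
  ∀ (x : M) (α : ∀ x : M, TangentSpace (𝓡 n) x →L[ℝ] ℝ), CovSmoothAt α x →
    VFSmoothAt (fun y => B y (α y)) x

namespace PrequantumBundle
variable {ι : Type*} {Ω : SymplecticForm n M} (L : PrequantumBundle ι Ω) (k : ℕ)

/-- Linear operators on smooth sections of the `k`-th power of the bundle. -/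
abbrev Op : Type _ := Module.End ℂ (L.Sec k)

noncomputable instance instRingOp : Ring (L.Op k) := Module.End.instRing

/-- An operator on sections, given by its expressions in the local frames. -/
def localOp (P : ι → (M → ℂ) → M → ℂ)
    (hgauge : ∀ i j x, x ∈ L.U i → x ∈ L.U j → ∀ ψ ∈ L.Sec k,
      P i (L.rep k i ψ) x = L.tr i j x ^ k * P j (L.rep k j ψ) x)
    (hsmooth : ∀ i, ∀ x ∈ L.U i, ∀ ψ ∈ L.Sec k,
      ContMDiffAt (𝓡 n) 𝓘(ℝ, ℂ) ∞ (P i (L.rep k i ψ)) x)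
    (hadd : ∀ i, ∀ x ∈ L.U i, ∀ ψ ∈ L.Sec k, ∀ φ ∈ L.Sec k,
      P i (fun y => L.rep k i ψ y + L.rep k i φ y) x
        = P i (L.rep k i ψ) x + P i (L.rep k i φ) x)
    (hsmul : ∀ i, ∀ x ∈ L.U i, ∀ (c : ℂ), ∀ ψ ∈ L.Sec k,
      P i (fun y => c * L.rep k i ψ y) x = c * P i (L.rep k i ψ) x) : L.Op k where
  toFun ψ := ⟨fun x => P (L.indexAt x) (L.rep k (L.indexAt x) ψ) x, by
    refine L.smooth_of_one k fun x => ⟨L.indexAt x, L.mem_indexAt x, ?_⟩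
    refine (hsmooth _ x (L.mem_indexAt x) ψ ψ.2).congr_of_eventuallyEq ?_
    filter_upwards [L.nhds_U (L.mem_indexAt x)] with y hy
    exact (hgauge _ _ y hy (L.mem_indexAt y) ψ ψ.2).symm⟩
  map_add' ψ φ := by
    ext x
    have : L.rep k (L.indexAt x) ((ψ + φ : L.Sec k) : M → ℂ) = fun y =>
        L.rep k (L.indexAt x) ψ y + L.rep k (L.indexAt x) φ y := by
      funext y; simp [rep, mul_add]
    change P _ (L.rep k (L.indexAt x) ((ψ + φ : L.Sec k) : M → ℂ)) x = _
    rw [this]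
    exact hadd _ x (L.mem_indexAt x) ψ ψ.2 φ φ.2
  map_smul' c ψ := by
    ext x
    have : L.rep k (L.indexAt x) ((c • ψ : L.Sec k) : M → ℂ) = fun y =>
        c * L.rep k (L.indexAt x) ψ y := by
      funext y; simp [rep]; ring
    change P _ (L.rep k (L.indexAt x) ((c • ψ : L.Sec k) : M → ℂ)) x = _
    rw [this]
    exact hsmul _ x (L.mem_indexAt x) c ψ ψ.2

/-- Multiplication by a smooth function. -/
def mulOp (f : M → ℂ) (hf : ∀ x, ContMDiffAt (𝓡 n) 𝓘(ℝ, ℂ) ∞ f x) : L.Op k :=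
  L.localOp k (fun _ ψ x => f x * ψ x)
    (fun i j x hi hj ψ _ => by rw [L.rep_gauge k hi hj]; ring)
    (fun i x hx ψ hψ => cmul_smoothAt (hf x) (hψ i x hx))
    (fun i x hx ψ hψ φ hφ => by ring) (fun i x hx c ψ hψ => by ring)

theorem rep_eventuallyEq {i j : ι} {x : M} (hi : x ∈ L.U i) (hj : x ∈ L.U j) (ψ : M → ℂ) :
    L.rep k i ψ =ᶠ[𝓝 x] fun y => L.tr i j y ^ k * L.rep k j ψ y := by
  filter_upwards [L.nhds_U hi, L.nhds_U hj] with y hy hy'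
  exact L.rep_gauge k hy hy' ψ

/-- The covariant derivative `∇_X` along a smooth real vector field. -/
noncomputable def nablaOp (X : ∀ x : M, TangentSpace (𝓡 n) x) (hX : ∀ x, VFSmoothAt X x) :
    L.Op k :=
  L.localOp k (fun i f x => L.covD k i f x (X x))
    (fun i j x hi hj ψ hψ => by
      rw [L.covD_congr k (L.rep_eventuallyEq k hi hj ψ), L.covD_gauge k hi hj (hψ j x hj)]; rfl)
    (fun i x hx ψ hψ => covSmoothAt_apply (L.covD_smoothAt k hx (hψ i x hx)) (hX x))
    (fun i x hx ψ hψ φ hφ => by rw [L.covD_add k (hψ i x hx) (hφ i x hx)]; rfl)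
    (fun i x hx c ψ hψ => by rw [L.covD_smul k c (hψ i x hx)]; rfl)

variable (D : SmoothConnection n M)
  (B : ∀ x : M, (TangentSpace (𝓡 n) x →L[ℝ] ℝ) →L[ℝ] TangentSpace (𝓡 n) x)

/-- Real part of the vector field `B · ∇f`, in the `i`-th frame. -/
noncomputable def gradRe (i : ι) (f : M → ℂ) (x : M) : TangentSpace (𝓡 n) x :=
  B x (Complex.reCLM ∘L L.covD k i f x)

/-- Imaginary part of the vector field `B · ∇f`, in the `i`-th frame. -/
noncomputable def gradIm (i : ι) (f : M → ℂ) (x : M) : TangentSpace (𝓡 n) x :=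
  B x (Complex.imCLM ∘L L.covD k i f x)

/-- The trace of the covariant derivative of the `TM ⊗ L^k`-valued field `B · ∇f`, in the `i`-th
frame. -/
noncomputable def lapLoc (i : ι) (f : M → ℂ) (x : M) : ℂ :=
  ((divergence D.toFun (L.gradRe k B i f) x : ℂ)
      + Complex.I * divergence D.toFun (L.gradIm k B i f) x)
    - Complex.I * k * ((L.θ i x (L.gradRe k B i f x) : ℂ)
      + Complex.I * L.θ i x (L.gradIm k B i f x))


variable {B}

theorem gradRe_smoothAt (hB : BivSmooth B) {i : ι} {x : M} (hi : x ∈ L.U i) {f : M → ℂ}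
    (hf : ContMDiffAt (𝓡 n) 𝓘(ℝ, ℂ) ∞ f x) : VFSmoothAt (L.gradRe k B i f) x :=
  hB x _ (CovSmoothAt.clm_comp Complex.reCLM (L.covD_smoothAt k hi hf))

theorem gradIm_smoothAt (hB : BivSmooth B) {i : ι} {x : M} (hi : x ∈ L.U i) {f : M → ℂ}
    (hf : ContMDiffAt (𝓡 n) 𝓘(ℝ, ℂ) ∞ f x) : VFSmoothAt (L.gradIm k B i f) x :=
  hB x _ (CovSmoothAt.clm_comp Complex.imCLM (L.covD_smoothAt k hi hf))

theorem lapLoc_congr (hB : BivSmooth B) {i : ι} {x : M} (hi : x ∈ L.U i) {f g : M → ℂ}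
    (hf : ContMDiffAt (𝓡 n) 𝓘(ℝ, ℂ) ∞ f x) (h : f =ᶠ[𝓝 x] g) :
    L.lapLoc k D B i f x = L.lapLoc k D B i g x := by
  have hg : ContMDiffAt (𝓡 n) 𝓘(ℝ, ℂ) ∞ g x := hf.congr_of_eventuallyEq h.symm
  have h1 : ∀ᶠ y in 𝓝 x, L.covD k i f y = L.covD k i g y :=
    h.eventuallyEq_nhds.mono fun y hy => L.covD_congr k hy
  have hR : ∀ᶠ y in 𝓝 x, L.gradRe k B i f y = L.gradRe k B i g y :=
    h1.mono fun y hy => by simp only [gradRe, hy]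
  have hI : ∀ᶠ y in 𝓝 x, L.gradIm k B i f y = L.gradIm k B i g y :=
    h1.mono fun y hy => by simp only [gradIm, hy]
  unfold lapLoc
  rw [D.div_congr (L.gradRe_smoothAt k hB hi hf) (L.gradRe_smoothAt k hB hi hg) hR,
    D.div_congr (L.gradIm_smoothAt k hB hi hf) (L.gradIm_smoothAt k hB hi hg) hI,
    hR.self_of_nhds, hI.self_of_nhds]

/-- The effect on `lapLoc` of multiplying `∇f` by a smooth function, possibly between frames. -/
theorem lapLoc_mul (hB : BivSmooth B) {i j : ι} {x : M} (hi : x ∈ L.U i) (hj : x ∈ L.U j) {f g h : M → ℂ}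
    (hf : ContMDiffAt (𝓡 n) 𝓘(ℝ, ℂ) ∞ f x) (hg : ContMDiffAt (𝓡 n) 𝓘(ℝ, ℂ) ∞ g x)
    (hh : ContMDiffAt (𝓡 n) 𝓘(ℝ, ℂ) ∞ h x)
    (hcov : ∀ᶠ y in 𝓝 x, L.covD k i g y = h y • L.covD k j f y) :
    L.lapLoc k D B i g x = h x * L.lapLoc k D B j f x
      + (mvfderiv (𝓡 n) h x (L.gradRe k B j f x)
          + Complex.I * mvfderiv (𝓡 n) h x (L.gradIm k B j f x))
      - Complex.I * k * h x * (((L.θ i x (L.gradRe k B j f x) : ℂ) - L.θ j x (L.gradRe k B j f x))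
        + Complex.I * ((L.θ i x (L.gradIm k B j f x) : ℂ) - L.θ j x (L.gradIm k B j f x))) := by
  have hR := L.gradRe_smoothAt k hB hj hf
  have hI := L.gradIm_smoothAt k hB hj hf
  have hre : ContMDiffAt (𝓡 n) 𝓘(ℝ, ℝ) ∞ (fun y => Complex.reCLM (h y)) x :=
    Complex.reCLM.contMDiff.contMDiffAt.comp x hh
  have him : ContMDiffAt (𝓡 n) 𝓘(ℝ, ℝ) ∞ (fun y => Complex.imCLM (h y)) x :=
    Complex.imCLM.contMDiff.contMDiffAt.comp x hh
  have himn : ContMDiffAt (𝓡 n) 𝓘(ℝ, ℝ) ∞ (fun y => - Complex.imCLM (h y)) x := him.neg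
  have eR : ∀ᶠ y in 𝓝 x, L.gradRe k B i g y = Complex.reCLM (h y) • L.gradRe k B j f y
      + (- Complex.imCLM (h y)) • L.gradIm k B j f y := by
    filter_upwards [hcov] with y hy
    simp only [gradRe, gradIm, hy, ← map_smul, ← map_add]
    congr 1
    ext v
    simp
    ring
  have eI : ∀ᶠ y in 𝓝 x, L.gradIm k B i g y = Complex.reCLM (h y) • L.gradIm k B j f y
      + Complex.imCLM (h y) • L.gradRe k B j f y := by
    filter_upwards [hcov] with y hy
    simp only [gradRe, gradIm, hy, ← map_smul, ← map_add]
    congr 1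
  have dR := D.div_congr (L.gradRe_smoothAt k hB hi hg)
    ((VFSmoothAt.smul hre hR).add (VFSmoothAt.smul himn hI)) eR
  have dI := D.div_congr (L.gradIm_smoothAt k hB hi hg)
    ((VFSmoothAt.smul hre hI).add (VFSmoothAt.smul him hR)) eI
  rw [D.div_add (VFSmoothAt.smul hre hR) (VFSmoothAt.smul himn hI), D.div_smul hre hR,
    D.div_smul himn hI] at dR
  rw [D.div_add (VFSmoothAt.smul hre hI) (VFSmoothAt.smul him hR), D.div_smul hre hI,
    D.div_smul him hR] at dI
  have hd := hh.mdifferentiableAt (by simp : (∞ : ℕ∞ω) ≠ 0)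
  have nim : ∀ v : TangentSpace (𝓡 n) x, mvfderiv (𝓡 n) (fun y => - Complex.imCLM (h y)) x v
      = - Complex.imCLM (mvfderiv (𝓡 n) h x v) := by
    intro v
    rw [mvfderiv_fun_neg]
    simp only [neg_apply, mvfderiv_clm_comp Complex.imCLM hd]
  simp only [nim, mvfderiv_clm_comp Complex.reCLM hd, mvfderiv_clm_comp Complex.imCLM hd] at dR dI
  unfold lapLoc
  rw [dR, dI, eR.self_of_nhds, eI.self_of_nhds]
  simp only [map_add, map_smul, smul_eq_mul, Complex.reCLM_apply, Complex.imCLM_apply]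
  push_cast
  generalize mvfderiv (𝓡 n) h x (L.gradRe k B j f x) = a
  generalize mvfderiv (𝓡 n) h x (L.gradIm k B j f x) = b
  obtain ⟨a1, a2⟩ := a
  obtain ⟨b1, b2⟩ := b
  apply Complex.ext <;> simp <;> ring

/-- The second-order operator `ψ ↦ tr ∇(B · ∇ψ) = ∇²_B ψ + ∇_{δB} ψ` for a real bivector
field `B`, where `∇` is formed from the connection of the line bundle and the connection `D`
on `TM`. -/
noncomputable def lapOp (hB : BivSmooth B) : L.Op k :=
  L.localOp k (fun i f x => L.lapLoc k D B i f x)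
    (fun i j x hi hj ψ hψ => by
      have hcov : ∀ᶠ y in 𝓝 x, L.covD k i (L.rep k i ψ) y
          = (fun y => L.tr i j y ^ k) y • L.covD k j (L.rep k j ψ) y := by
        filter_upwards [L.nhds_U hi, L.nhds_U hj] with y hy hy'
        rw [L.covD_congr k (L.rep_eventuallyEq k hy hy' ψ), L.covD_gauge k hy hy' (hψ j y hy')]
      rw [L.lapLoc_mul k D hB hi hj (hψ j x hj) (hψ i x hi)
        (cpow_smoothAt (L.tr_smooth i j x hi hj) k) hcov]
      simp only [L.mvfderiv_tr_pow k hi hj]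
      ring)
    (fun i x hx ψ hψ => by
      have hR := D.div_smoothAt (L.isOpen_U i)
        (fun y hy => L.gradRe_smoothAt k hB hy (hψ i y hy)) hx
      have hI := D.div_smoothAt (L.isOpen_U i)
        (fun y hy => L.gradIm_smoothAt k hB hy (hψ i y hy)) hx
      have tR := covSmoothAt_apply (L.θ_smooth i x hx) (L.gradRe_smoothAt k hB hx (hψ i x hx))
      have tI := covSmoothAt_apply (L.θ_smooth i x hx) (L.gradIm_smoothAt k hB hx (hψ i x hx))
      have of : ∀ {f : M → ℝ}, ContMDiffAt (𝓡 n) 𝓘(ℝ, ℝ) ∞ f x →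
          ContMDiffAt (𝓡 n) 𝓘(ℝ, ℂ) ∞ (fun y => (f y : ℂ)) x := fun h =>
        Complex.ofRealCLM.contMDiff.contMDiffAt.comp x h
      exact ((of hR).add (cmul_smoothAt contMDiffAt_const (of hI))).sub
        (cmul_smoothAt contMDiffAt_const ((of tR).add (cmul_smoothAt contMDiffAt_const (of tI)))))
    (fun i x hx ψ hψ φ hφ => by
      have eR : ∀ᶠ y in 𝓝 x, L.gradRe k B i (fun y => L.rep k i ψ y + L.rep k i φ y) y
          = L.gradRe k B i (L.rep k i ψ) y + L.gradRe k B i (L.rep k i φ) y := by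
        filter_upwards [L.nhds_U hx] with y hy
        simp only [gradRe, L.covD_add k (hψ i y hy) (hφ i y hy), ← map_add]
        congr 1
      have eI : ∀ᶠ y in 𝓝 x, L.gradIm k B i (fun y => L.rep k i ψ y + L.rep k i φ y) y
          = L.gradIm k B i (L.rep k i ψ) y + L.gradIm k B i (L.rep k i φ) y := by
        filter_upwards [L.nhds_U hx] with y hy
        simp only [gradIm, L.covD_add k (hψ i y hy) (hφ i y hy), ← map_add]
        congr 1
      have hs : ContMDiffAt (𝓡 n) 𝓘(ℝ, ℂ) ∞ (fun y => L.rep k i ψ y + L.rep k i φ y) x :=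
        (hψ i x hx).add (hφ i x hx)
      have r1 := L.gradRe_smoothAt k hB hx (hψ i x hx)
      have r2 := L.gradRe_smoothAt k hB hx (hφ i x hx)
      have i1 := L.gradIm_smoothAt k hB hx (hψ i x hx)
      have i2 := L.gradIm_smoothAt k hB hx (hφ i x hx)
      unfold lapLoc
      rw [D.div_congr (L.gradRe_smoothAt k hB hx hs) (r1.add r2) eR,
        D.div_congr (L.gradIm_smoothAt k hB hx hs) (i1.add i2) eI, eR.self_of_nhds,
        eI.self_of_nhds, D.div_add r1 r2, D.div_add i1 i2]
      simp only [map_add]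
      push_cast
      ring)
    (fun i x hx c ψ hψ => by
      have hcov : ∀ᶠ y in 𝓝 x, L.covD k i (fun y => c * L.rep k i ψ y) y
          = (fun _ => c) y • L.covD k i (L.rep k i ψ) y := by
        filter_upwards [L.nhds_U hx] with y hy
        exact L.covD_smul k c (hψ i y hy)
      rw [L.lapLoc_mul k D hB hx hx (hψ i x hx) (cmul_smoothAt contMDiffAt_const (hψ i x hx))
        contMDiffAt_const hcov]
      simp [mvfderiv_const])
end PrequantumBundle
end Geometry

section Geometry
variable {n : ℕ} {M : Type*} [TopologicalSpace M] [ChartedSpace (Rn n) M]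
  [IsManifold (𝓡 n) ∞ M]

/-- A Levi-Civita connection of the metric `g`: a torsion-free metric connection on `TM`. -/
structure LeviCivitaConnection
    (g : ∀ x : M, TangentSpace (𝓡 n) x → TangentSpace (𝓡 n) x → ℝ) extends
    SmoothConnection n M where
  torsion_free : toCovariantDerivative.torsion = 0
  metric : ∀ X Y : ∀ x : M, TangentSpace (𝓡 n) x, (∀ x, VFSmoothAt X x) → (∀ x, VFSmoothAt Y x) →
    ∀ (x : M) (v : TangentSpace (𝓡 n) x),
      mvfderiv (𝓡 n) (fun y => g y (X y) (Y y)) x v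
        = g x (toFun X x v) (Y x) + g x (X x) (toFun Y x v)

/-- A complex manifold is in particular a real smooth manifold. -/
instance isManifold_real {ET T : Type*} [NormedAddCommGroup ET] [NormedSpace ℂ ET]
    [TopologicalSpace T] [ChartedSpace ET T] [h : IsManifold 𝓘(ℂ, ET) ∞ T] :
    IsManifold 𝓘(ℝ, ET) ∞ T := by
  refine isManifold_of_contDiffOn _ _ _ fun e e' he he' => ?_
  have := (contDiffGroupoid ∞ 𝓘(ℂ, ET)).compatible he he'
  rw [contDiffGroupoid, mem_groupoid_of_pregroupoid] at this
  have h1 := this.1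
  simp [contDiffPregroupoid] at h1
  simp
  exact h1.restrict_scalars ℝ

/-- Multiplication by `i` on tangent vectors of a complex manifold. -/
noncomputable def tangentI {ET T : Type*} [NormedAddCommGroup ET] [NormedSpace ℂ ET]
    [TopologicalSpace T] [ChartedSpace ET T] {σ : T} (V : TangentSpace 𝓘(ℝ, ET) σ) :
    TangentSpace 𝓘(ℝ, ET) σ :=
  let v : ET := V
  (Complex.I • v : ET)

variable {ET T : Type*} [NormedAddCommGroup ET] [NormedSpace ℂ ET]
  [TopologicalSpace T] [ChartedSpace ET T] [IsManifold 𝓘(ℂ, ET) ∞ T]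

theorem mvfderiv_apply_apply {W W' W'' : Type*} [NormedAddCommGroup W] [NormedSpace ℝ W]
    [NormedAddCommGroup W'] [NormedSpace ℝ W'] [NormedAddCommGroup W''] [NormedSpace ℝ W'']
    (c : W' →L[ℝ] W'') (a : W) {f : T → (W →L[ℝ] W')} {σ : T}
    (h : MDifferentiableAt 𝓘(ℝ, ET) 𝓘(ℝ, W →L[ℝ] W') f σ) (V : TangentSpace 𝓘(ℝ, ET) σ) :
    mvfderiv 𝓘(ℝ, ET) (fun τ => c (f τ a)) σ V = c (mvfderiv 𝓘(ℝ, ET) f σ V a) :=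
  mvfderiv_clm_comp (c ∘L ContinuousLinearMap.apply ℝ W' a) h V

variable (ET T) in
/-- A smooth family, parametrised by the complex manifold `T`, of almost complex structures on `M`
compatible with the symplectic form. -/
structure CompatibleFamily (Ω : SymplecticForm n M) where
  J : T → ∀ x : M, TangentSpace (𝓡 n) x →L[ℝ] TangentSpace (𝓡 n) x
  smooth : ∀ (x₀ : M) (σ : T), ContMDiffAt ((𝓡 n).prod 𝓘(ℝ, ET)) 𝓘(ℝ, Rn n →L[ℝ] Rn n) ∞
    (fun p : M × T => coframeAt x₀ p.1 ∘L J p.2 p.1 ∘L frameAt x₀ p.1) (x₀, σ)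
  sq : ∀ σ x u, J σ x (J σ x u) = -u
  compatible : ∀ σ x u v, Ω.form x (J σ x u) (J σ x v) = Ω.form x u v
  pos : ∀ σ x u, u ≠ 0 → 0 < Ω.form x u (J σ x u)

namespace CompatibleFamily
variable {Ω : SymplecticForm n M} (K : CompatibleFamily ET T Ω)

/-- The metric `g_σ(u, v) = ω(u, J_σ v)`. -/
noncomputable def metric (σ : T) (x : M) (u v : TangentSpace (𝓡 n) x) : ℝ := Ω.form x u (K.J σ x v)

/-- The inverse metric `g̃_σ : T*M → TM`. -/
noncomputable def invMetric (σ : T) (x : M) :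
    (TangentSpace (𝓡 n) x →L[ℝ] ℝ) →L[ℝ] TangentSpace (𝓡 n) x :=
  K.J σ x ∘L Ω.sharp x

theorem metric_invMetric (σ : T) (x : M) (α : TangentSpace (𝓡 n) x →L[ℝ] ℝ)
    (v : TangentSpace (𝓡 n) x) : K.metric σ x (K.invMetric σ x α) v = α v := by
  simp [metric, invMetric, K.compatible, Ω.form_sharp]

/-- The map `σ ↦ g̃_σ` at a fixed point of `M`, with values in a fixed normed space. -/
noncomputable def invMetricAt (x : M) (σ : T) : (Rn n →L[ℝ] ℝ) →L[ℝ] Rn n := K.invMetric σ x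

/-- `G̃(V) = -V[g̃]`. -/
noncomputable def Gtilde (σ : T) (V : TangentSpace 𝓘(ℝ, ET) σ) (x : M) :
    (TangentSpace (𝓡 n) x →L[ℝ] ℝ) →L[ℝ] TangentSpace (𝓡 n) x :=
  (- mvfderiv 𝓘(ℝ, ET) (K.invMetricAt x) σ V : (Rn n →L[ℝ] ℝ) →L[ℝ] Rn n)

theorem slice_smoothAt (x : M) (σ : T) : ContMDiffAt 𝓘(ℝ, ET) ((𝓡 n).prod 𝓘(ℝ, ET)) ∞
    (fun τ : T => (x, τ)) σ := contMDiffAt_const.prodMk contMDiffAt_id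

theorem J_apply_smoothAt (σ : T) {X : ∀ x : M, TangentSpace (𝓡 n) x} {x₀ : M}
    (hX : VFSmoothAt X x₀) : VFSmoothAt (fun x => K.J σ x (X x)) x₀ := by
  rw [vfSmoothAt_iff] at *
  have h : ContMDiffAt (𝓡 n) 𝓘(ℝ, Rn n →L[ℝ] Rn n) ∞
      (fun x : M => coframeAt x₀ x ∘L K.J σ x ∘L frameAt x₀ x) x₀ :=
    (K.smooth x₀ σ).comp x₀ (f := fun x : M => (x, σ)) (contMDiffAt_id.prodMk contMDiffAt_const)
  refine (h.clm_apply hX).congr_of_eventuallyEq ?_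
  filter_upwards [chart_mem_nhds (n := n) x₀] with x hx
  simp [frame_coframe hx]

theorem comp_J_smoothAt (σ : T) {α : ∀ x : M, TangentSpace (𝓡 n) x →L[ℝ] ℝ} {x₀ : M}
    (hα : CovSmoothAt α x₀) : CovSmoothAt (fun x => α x ∘L K.J σ x) x₀ := by
  unfold CovSmoothAt at *
  have h : ContMDiffAt (𝓡 n) 𝓘(ℝ, Rn n →L[ℝ] Rn n) ∞
      (fun x : M => coframeAt x₀ x ∘L K.J σ x ∘L frameAt x₀ x) x₀ :=
    (K.smooth x₀ σ).comp x₀ (f := fun x : M => (x, σ)) (contMDiffAt_id.prodMk contMDiffAt_const)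
  refine (hα.clm_comp h).congr_of_eventuallyEq ?_
  filter_upwards [chart_mem_nhds (n := n) x₀] with x hx
  ext v
  simp [frame_coframe hx]

theorem invMetric_mdiff (σ : T) (x : M) :
    MDifferentiableAt 𝓘(ℝ, ET) 𝓘(ℝ, (Rn n →L[ℝ] ℝ) →L[ℝ] Rn n)
      (K.invMetricAt x) σ := by
  have h : ContMDiffAt 𝓘(ℝ, ET) 𝓘(ℝ, Rn n →L[ℝ] Rn n) ∞
      (fun τ : T => coframeAt x x ∘L K.J τ x ∘L frameAt x x) σ :=
    (K.smooth x σ).comp σ (f := fun τ : T => (x, τ)) (slice_smoothAt x σ)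
  let a : Rn n →L[ℝ] Rn n := frameAt x x
  let c : Rn n →L[ℝ] Rn n := coframeAt x x
  let s : (Rn n →L[ℝ] ℝ) →L[ℝ] Rn n := Ω.sharp x
  have h2 : ContMDiffAt 𝓘(ℝ, ET) 𝓘(ℝ, (Rn n →L[ℝ] ℝ) →L[ℝ] Rn n) ∞
      (fun τ : T => (a ∘L (coframeAt x x ∘L K.J τ x ∘L frameAt x x)) ∘L (c ∘L s)) σ :=
    (contMDiffAt_const.clm_comp h).clm_comp contMDiffAt_const
  refine (h2.congr_of_eventuallyEq ?_).mdifferentiableAt (by simp)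
  filter_upwards with τ
  ext1 α
  change K.J τ x (Ω.sharp x α) = frameAt x x (coframeAt x x (K.J τ x (frameAt x x
    (coframeAt x x (Ω.sharp x α)))))
  rw [frame_coframe (mem_chart_source _ x), frame_coframe (mem_chart_source _ x)]

theorem coframe_Gtilde (σ : T) (V : TangentSpace 𝓘(ℝ, ET) σ) (x₀ x : M)
    (α : TangentSpace (𝓡 n) x →L[ℝ] ℝ) : coframeAt x₀ x (K.Gtilde σ V x α)
      = - mvfderiv 𝓘(ℝ, ET) (fun τ => coframeAt x₀ x (K.J τ x (Ω.sharp x α))) σ V := by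
  let c : Rn n →L[ℝ] Rn n := coframeAt x₀ x
  let a : Rn n →L[ℝ] ℝ := α
  let w : Rn n := mvfderiv 𝓘(ℝ, ET) (K.invMetricAt x) σ V a
  have h1 : mvfderiv 𝓘(ℝ, ET) (fun τ => c (K.invMetricAt x τ a)) σ V = c w :=
    mvfderiv_apply_apply c a (K.invMetric_mdiff σ x) V
  have h2 : coframeAt x₀ x (K.Gtilde σ V x α) = c (-w) := rfl
  rw [h2, map_neg, ← h1]
  rfl

theorem Gtilde_smooth (σ : T) (V : TangentSpace 𝓘(ℝ, ET) σ) : BivSmooth (K.Gtilde σ V) := by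
  intro x₀ α hα
  rw [vfSmoothAt_iff]
  have hs := (vfSmoothAt_iff _ _).1 (Ω.sharp_smoothAt hα)
  let f : M → T → Rn n := fun x τ => coframeAt x₀ x (K.J τ x (Ω.sharp x (α x)))
  have hf : ContMDiffAt ((𝓡 n).prod 𝓘(ℝ, ET)) 𝓘(ℝ, Rn n) ∞ (fun p : M × T => f p.1 p.2)
      (x₀, σ) := by
    have h1 : ContMDiffAt ((𝓡 n).prod 𝓘(ℝ, ET)) 𝓘(ℝ, Rn n) ∞
        (fun p : M × T => coframeAt x₀ p.1 (Ω.sharp p.1 (α p.1))) (x₀, σ) :=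
      ContMDiffAt.comp (x := (x₀, σ)) (f := Prod.fst) (I' := 𝓡 n) hs contMDiffAt_fst
    refine ((K.smooth x₀ σ).clm_apply h1).congr_of_eventuallyEq ?_
    have : ∀ᶠ p : M × T in 𝓝 (x₀, σ), p.1 ∈ (chartAt (Rn n) x₀).source :=
      continuousAt_fst.eventually (chart_mem_nhds (n := n) x₀)
    filter_upwards [this] with p hp
    simp [f, frame_coframe hp]
  refine (partial_smoothAt hf V).neg.congr_of_eventuallyEq ?_
  filter_upwards with x
  exact K.coframe_Gtilde σ V x₀ x (α x)

/-- Real part of `G(V) = (π ⊗ π) G̃(V)`, where `π = (1 - iJ)/2` is the projection onto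
the vectors of type `(1,0)`. -/
noncomputable def Gre (σ : T) (V : TangentSpace 𝓘(ℝ, ET) σ) (x : M) :
    (TangentSpace (𝓡 n) x →L[ℝ] ℝ) →L[ℝ] TangentSpace (𝓡 n) x :=
  (1 / 4 : ℝ) • (K.Gtilde σ V x - K.J σ x ∘L K.Gtilde σ V x ∘L (K.J σ x).precomp ℝ)

/-- Imaginary part of `G(V)`. -/
noncomputable def Gim (σ : T) (V : TangentSpace 𝓘(ℝ, ET) σ) (x : M) :
    (TangentSpace (𝓡 n) x →L[ℝ] ℝ) →L[ℝ] TangentSpace (𝓡 n) x :=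
  (-1 / 4 : ℝ) • (K.J σ x ∘L K.Gtilde σ V x + K.Gtilde σ V x ∘L (K.J σ x).precomp ℝ)

theorem Gre_smooth (σ : T) (V : TangentSpace 𝓘(ℝ, ET) σ) : BivSmooth (K.Gre σ V) := by
  intro x α hα
  have h1 := K.Gtilde_smooth σ V x α hα
  have h2 := K.J_apply_smoothAt σ (K.Gtilde_smooth σ V x _ (K.comp_J_smoothAt σ hα))
  have h3 := VFSmoothAt.smul (f := fun _ => 1 / 4) contMDiffAt_const
    (h1.add (VFSmoothAt.smul (f := fun _ => -1) contMDiffAt_const h2))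
  have aux : ∀ (y : M) (a b : TangentSpace (𝓡 n) y),
      (1 / 4 : ℝ) • (a + (-1 : ℝ) • b) = (1 / 4 : ℝ) • (a - b) := fun y a b => by
    rw [neg_one_smul, sub_eq_add_neg]
  simp only [aux] at h3
  exact h3

theorem Gim_smooth (σ : T) (V : TangentSpace 𝓘(ℝ, ET) σ) : BivSmooth (K.Gim σ V) := by
  intro x α hα
  have h1 := K.J_apply_smoothAt σ (K.Gtilde_smooth σ V x α hα)
  have h2 := K.Gtilde_smooth σ V x _ (K.comp_J_smoothAt σ hα)
  exact VFSmoothAt.smul (f := fun _ => -1 / 4) contMDiffAt_const (h1.add h2)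

end CompatibleFamily
end Geometry

section Geometry
variable {n : ℕ} {M : Type*} [TopologicalSpace M] [ChartedSpace (Rn n) M]
  [IsManifold (𝓡 n) ∞ M]

namespace PrequantumBundle
variable {ι : Type*} {Ω : SymplecticForm n M} (L : PrequantumBundle ι Ω) (k : ℕ)

/-- `D` is a differential operator of order less than `N` (Grothendieck's definition: iterated
commutators with multiplication operators). -/
def HasOrderLT : ℕ → L.Op k → Prop
  | 0, D => D = 0
  | N + 1, D => ∀ (f : M → ℂ) (hf : ∀ x, ContMDiffAt (𝓡 n) 𝓘(ℝ, ℂ) ∞ f x),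
      HasOrderLT N (D * L.mulOp k f hf - L.mulOp k f hf * D)

theorem hasOrderLT_zero (N : ℕ) : L.HasOrderLT k N 0 := by
  induction N with
  | zero => rfl
  | succ N ih => intro f hf; simpa using ih

theorem HasOrderLT.succ {N : ℕ} {D : L.Op k} (h : L.HasOrderLT k N D) :
    L.HasOrderLT k (N + 1) D := by
  induction N generalizing D with
  | zero =>
    have h0 : D = 0 := h
    rw [h0]; exact L.hasOrderLT_zero k 1
  | succ N ih => exact fun f hf => ih (h f hf)

theorem HasOrderLT.mono {N N' : ℕ} (hN : N ≤ N') {D : L.Op k} (h : L.HasOrderLT k N D) :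
    L.HasOrderLT k N' D := by
  induction N', hN using Nat.le_induction with
  | base => exact h
  | succ N' _ ih => exact HasOrderLT.succ L k ih

theorem HasOrderLT.add {N : ℕ} {A B : L.Op k} (hA : L.HasOrderLT k N A)
    (hB : L.HasOrderLT k N B) : L.HasOrderLT k N (A + B) := by
  induction N generalizing A B with
  | zero =>
    have h1 : A = 0 := hA
    have h2 : B = 0 := hB
    rw [h1, h2]
    exact add_zero 0
  | succ N ih =>
    intro f hf
    have := ih (hA f hf) (hB f hf)
    convert this using 1
    noncomm_ring

theorem HasOrderLT.mul {a b : ℕ} {A B : L.Op k} (hA : L.HasOrderLT k a A)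
    (hB : L.HasOrderLT k b B) : L.HasOrderLT k (a + b) (A * B) := by
  induction h : a + b generalizing a b A B with
  | zero =>
    obtain ⟨rfl, rfl⟩ : a = 0 ∧ b = 0 := by omega
    have h1 : A = 0 := hA
    rw [h1, zero_mul]; exact L.hasOrderLT_zero k _
  | succ N ih =>
    rcases a with _ | a
    · have h1 : A = 0 := hA
      rw [h1, zero_mul]; exact L.hasOrderLT_zero k _
    rcases b with _ | b
    · have h1 : B = 0 := hB
      rw [h1, mul_zero]; exact L.hasOrderLT_zero k _
    intro f hf
    have e1 := ih hA (hB f hf) (by omega)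
    have e2 := ih (hA f hf) hB (by omega)
    convert HasOrderLT.add L k e1 e2 using 1
    noncomm_ring

/-- The algebra of finite-order differential operators on sections of the `k`-th power. -/
def DiffOps : Subalgebra ℂ (L.Op k) where
  carrier := {D | ∃ N, L.HasOrderLT k N D}
  mul_mem' := fun ⟨a, ha⟩ ⟨b, hb⟩ => ⟨a + b, HasOrderLT.mul L k ha hb⟩
  add_mem' := fun ⟨a, ha⟩ ⟨b, hb⟩ => ⟨max a b, HasOrderLT.add L k
    (HasOrderLT.mono L k (le_max_left a b) ha) (HasOrderLT.mono L k (le_max_right a b) hb)⟩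
  algebraMap_mem' c := ⟨1, fun f hf => by
    have : algebraMap ℂ (L.Op k) c * L.mulOp k f hf - L.mulOp k f hf * algebraMap ℂ (L.Op k) c
        = 0 := by rw [Algebra.commutes, sub_self]
    rw [this]; rfl⟩

variable {ET T : Type*} [NormedAddCommGroup ET] [NormedSpace ℂ ET]
  [TopologicalSpace T] [ChartedSpace ET T] [IsManifold 𝓘(ℂ, ET) ∞ T]

variable (ET T) in
/-- Differential operators on sections depending smoothly on a parameter `σ ∈ T`: every section
`(x, σ) ↦ (D_σ ψ)(x)` of the pull-back of the bundle to `M × T` is smooth. -/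
def OpFamily : Submodule ℂ (T → L.Op k) where
  carrier := {D | (∀ σ, D σ ∈ L.DiffOps k) ∧
    ∀ (ψ : L.Sec k) (i : ι), ∀ x ∈ L.U i, ∀ σ : T,
      ContMDiffAt ((𝓡 n).prod 𝓘(ℝ, ET)) 𝓘(ℝ, ℂ) ∞
        (fun p : M × T => L.rep k i (D p.2 ψ : L.Sec k) p.1) (x, σ)}
  zero_mem' := ⟨fun σ => (L.DiffOps k).zero_mem, fun ψ i x _ σ => by
    have : (fun p : M × T => L.rep k i (((0 : T → L.Op k) p.2 ψ : L.Sec k)) p.1)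
        = fun _ => 0 := by funext p; simp [rep]
    rw [this]; exact contMDiffAt_const⟩
  add_mem' {A B} hA hB := ⟨fun σ => (L.DiffOps k).add_mem (hA.1 σ) (hB.1 σ), fun ψ i x hx σ => by
    have : (fun p : M × T => L.rep k i (((A + B) p.2 ψ : L.Sec k)) p.1)
        = fun p => L.rep k i (A p.2 ψ : L.Sec k) p.1 + L.rep k i (B p.2 ψ : L.Sec k) p.1 := by
      funext p; simp [rep, mul_add]
    rw [this]; exact (hA.2 ψ i x hx σ).add (hB.2 ψ i x hx σ)⟩
  smul_mem' c A hA := ⟨fun σ => (L.DiffOps k).smul_mem (hA.1 σ) c, fun ψ i x hx σ => by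
    have : (fun p : M × T => L.rep k i (((c • A) p.2 ψ : L.Sec k)) p.1)
        = fun p => c * L.rep k i (A p.2 ψ : L.Sec k) p.1 := by
      funext p; simp [rep]; ring
    rw [this]; exact cmul_smoothAt contMDiffAt_const (hA.2 ψ i x hx σ)⟩

variable {L k}

theorem OpFamily.slice_mdiff (D : L.OpFamily k ET T) (ψ : L.Sec k) {i : ι} {x : M}
    (hx : x ∈ L.U i) (σ : T) : MDifferentiableAt 𝓘(ℝ, ET) 𝓘(ℝ, ℂ)
      (fun τ => L.rep k i (D.1 τ ψ : L.Sec k) x) σ :=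
  ((D.2.2 ψ i x hx σ).comp σ (f := fun τ : T => (x, τ))
    (CompatibleFamily.slice_smoothAt x σ)).mdifferentiableAt (by simp)

theorem OpFamily.slice_mdiff' (D : L.OpFamily k ET T) (ψ : L.Sec k) (x : M) (σ : T) :
    MDifferentiableAt 𝓘(ℝ, ET) 𝓘(ℝ, ℂ) (fun τ => (D.1 τ ψ : L.Sec k).1 x) σ := by
  have := OpFamily.slice_mdiff D ψ (L.mem_indexAt x) σ
  simpa only [rep_indexAt] using this

/-- The derivative `V[D]` at `σ` of a family of operators along `V ∈ T_σ T`: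
`(V[D] ψ)(x)` is the derivative at `σ` of `τ ↦ (D_τ ψ)(x)` along `V`. -/
noncomputable def OpFamily.deriv (D : L.OpFamily k ET T) (σ : T) (V : TangentSpace 𝓘(ℝ, ET) σ) :
    L.Op k where
  toFun ψ := ⟨fun x => mvfderiv 𝓘(ℝ, ET) (fun τ => (D.1 τ ψ : L.Sec k).1 x) σ V, by
    intro i x hx
    have h := partial_smoothAt (f := fun x τ => L.rep k i (D.1 τ ψ : L.Sec k) x)
      (D.2.2 ψ i x hx σ) V
    refine h.congr_of_eventuallyEq ?_
    filter_upwards with y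
    exact (mvfderiv_clm_comp (ContinuousLinearMap.mul ℝ ℂ (L.tr i (L.indexAt y) y ^ k))
      (OpFamily.slice_mdiff' D ψ y σ) V).symm⟩
  map_add' ψ φ := by
    ext x
    have h := mvfderiv_fun_add (OpFamily.slice_mdiff' D ψ x σ) (OpFamily.slice_mdiff' D φ x σ)
    have h' := DFunLike.congr_fun h V
    have e : (fun τ => (D.1 τ (ψ + φ) : L.Sec k).1 x) = fun τ =>
        (D.1 τ ψ : L.Sec k).1 x + (D.1 τ φ : L.Sec k).1 x := by
      funext τ; rw [map_add]; rfl
    change mvfderiv 𝓘(ℝ, ET) (fun τ => (D.1 τ (ψ + φ) : L.Sec k).1 x) σ V = _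
    rw [e]
    exact h'
  map_smul' c ψ := by
    ext x
    have e : (fun τ => (D.1 τ (c • ψ) : L.Sec k).1 x) = fun τ =>
        ContinuousLinearMap.mul ℝ ℂ c ((D.1 τ ψ : L.Sec k).1 x) := by
      funext τ; rw [map_smul]; rfl
    change mvfderiv 𝓘(ℝ, ET) (fun τ => (D.1 τ (c • ψ) : L.Sec k).1 x) σ V = _
    rw [e]
    exact mvfderiv_clm_comp (ContinuousLinearMap.mul ℝ ℂ c) (OpFamily.slice_mdiff' D ψ x σ) V

end PrequantumBundle
end Geometry

section Geometry
variable {n : ℕ} {M : Type*} [TopologicalSpace M] [ChartedSpace (Rn n) M]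
  [IsManifold (𝓡 n) ∞ M]
variable {ET T : Type*} [NormedAddCommGroup ET] [NormedSpace ℂ ET]
  [TopologicalSpace T] [ChartedSpace ET T] [IsManifold 𝓘(ℂ, ET) ∞ T]

variable (ET T) in
/-- The data on `M` entering the Hitchin-Witten connection: the family of complex structures with
the Levi-Civita connections of the metrics `g_σ`, the real function `F` on `M × T` and the real
constant `λ`. -/
structure HitchinWittenData (Ω : SymplecticForm n M) extends CompatibleFamily ET T Ω where
  lc : ∀ σ : T, LeviCivitaConnection (toCompatibleFamily.metric σ)
  F : M → T → ℝ
  F_smooth : ∀ (x : M) (σ : T), ContMDiffAt ((𝓡 n).prod 𝓘(ℝ, ET)) 𝓘(ℝ, ℝ) ∞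
    (fun p : M × T => F p.1 p.2) (x, σ)
  lam : ℝ

namespace HitchinWittenData
variable {Ω : SymplecticForm n M} (H : HitchinWittenData ET T Ω)

/-- The differential of `F` along `M`, at a fixed `σ`. -/
noncomputable def dF (σ : T) (x : M) : TangentSpace (𝓡 n) x →L[ℝ] ℝ :=
  mvfderiv (𝓡 n) (fun y => H.F y σ) x

theorem dF_smoothAt (σ : T) (x : M) : CovSmoothAt (H.dF σ) x :=
  covSmoothAt_mvfderiv ((H.F_smooth x σ).comp x (f := fun y : M => (y, σ))
    (contMDiffAt_id.prodMk contMDiffAt_const))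

/-- `V[F]`, the derivative of `F` along `T`. -/
noncomputable def VF (σ : T) (V : TangentSpace 𝓘(ℝ, ET) σ) (x : M) : ℝ :=
  mvfderiv 𝓘(ℝ, ET) (H.F x) σ V

theorem VF_smoothAt (σ : T) (V : TangentSpace 𝓘(ℝ, ET) σ) (x : M) :
    ContMDiffAt (𝓡 n) 𝓘(ℝ, ℂ) ∞ (fun y => (H.VF σ V y : ℂ)) x :=
  Complex.ofRealCLM.contMDiff.contMDiffAt.comp x (partial_smoothAt (H.F_smooth x σ) V)

/-- `V'[F] = (V[F] - i (iV)[F]) / 2`, the derivative of `F` along the part of `V` of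
type `(1,0)`. -/
noncomputable def dF10 (σ : T) (V : TangentSpace 𝓘(ℝ, ET) σ) (x : M) : ℂ :=
  (1 / 2 : ℂ) * ((H.VF σ V x : ℂ) + (-Complex.I) * H.VF σ (tangentI V) x)

/-- `V''[F] = (V[F] + i (iV)[F]) / 2`, the derivative of `F` along the part of `V` of
type `(0,1)`. -/
noncomputable def dF01 (σ : T) (V : TangentSpace 𝓘(ℝ, ET) σ) (x : M) : ℂ :=
  (1 / 2 : ℂ) * ((H.VF σ V x : ℂ) + Complex.I * H.VF σ (tangentI V) x)

theorem dF10_smoothAt (σ : T) (V : TangentSpace 𝓘(ℝ, ET) σ) (x : M) :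
    ContMDiffAt (𝓡 n) 𝓘(ℝ, ℂ) ∞ (H.dF10 σ V) x :=
  cmul_smoothAt contMDiffAt_const ((H.VF_smoothAt σ V x).add
    (cmul_smoothAt contMDiffAt_const (H.VF_smoothAt σ (tangentI V) x)))

theorem dF01_smoothAt (σ : T) (V : TangentSpace 𝓘(ℝ, ET) σ) (x : M) :
    ContMDiffAt (𝓡 n) 𝓘(ℝ, ℂ) ∞ (H.dF01 σ V) x :=
  cmul_smoothAt contMDiffAt_const ((H.VF_smoothAt σ V x).add
    (cmul_smoothAt contMDiffAt_const (H.VF_smoothAt σ (tangentI V) x)))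

variable {ι : Type*} (L : PrequantumBundle ι Ω) (k : ℕ)

/-- `Δ_B + 2 ∇_{B · dF}` for the real part `B` of `G(V)`. -/
noncomputable def opRe (σ : T) (V : TangentSpace 𝓘(ℝ, ET) σ) : L.Op k :=
  L.lapOp k (H.lc σ).toSmoothConnection (H.Gre_smooth σ V)
    + (2 : ℂ) • L.nablaOp k (fun x => H.Gre σ V x (H.dF σ x))
      (fun x => H.Gre_smooth σ V x _ (H.dF_smoothAt σ x))

/-- `Δ_B + 2 ∇_{B · dF}` for the imaginary part `B` of `G(V)`. -/
noncomputable def opIm (σ : T) (V : TangentSpace 𝓘(ℝ, ET) σ) : L.Op k :=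
  L.lapOp k (H.lc σ).toSmoothConnection (H.Gim_smooth σ V)
    + (2 : ℂ) • L.nablaOp k (fun x => H.Gim σ V x (H.dF σ x))
      (fun x => H.Gim_smooth σ V x _ (H.dF_smoothAt σ x))

/-- `b(V) = Δ_{G(V)} + 2 ∇_{G(V) · dF} - 2 λ V'[F]`. -/
noncomputable def b (σ : T) (V : TangentSpace 𝓘(ℝ, ET) σ) : L.Op k :=
  H.opRe L k σ V + Complex.I • H.opIm L k σ V
    - (2 * H.lam : ℂ) • L.mulOp k (H.dF10 σ V) (H.dF10_smoothAt σ V)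

/-- `b̄(V) = Δ_{Ḡ(V)} + 2 ∇_{Ḡ(V) · dF} - 2 λ V''[F]`. -/
noncomputable def bbar (σ : T) (V : TangentSpace 𝓘(ℝ, ET) σ) : L.Op k :=
  H.opRe L k σ V - Complex.I • H.opIm L k σ V
    - (2 * H.lam : ℂ) • L.mulOp k (H.dF01 σ V) (H.dF01_smoothAt σ V)

variable {L k}

/-- The covariant derivative `∇^F_V D` of a family of operators, induced by `d + dF`
on sections: `V[D] + [V[F], D]`. -/
noncomputable def nablaF (D : L.OpFamily k ET T) (σ : T) (V : TangentSpace 𝓘(ℝ, ET) σ) : L.Op k :=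
  PrequantumBundle.OpFamily.deriv D σ V + ⁅L.mulOp k (fun x => (H.VF σ V x : ℂ)) (H.VF_smoothAt σ V), D.1 σ⁆

/-- The covariant derivative of a family of operators for the connection induced by the
Hitchin-Witten connection at level `t = k + is`:
`∇^F_V D + (1/2t) [b(V), D] - (1/2t̄) [b̄(V), D]`. -/
noncomputable def hwDeriv (s : ℝ) (D : L.OpFamily k ET T) (σ : T)
    (V : TangentSpace 𝓘(ℝ, ET) σ) : L.Op k :=
  let t : ℂ := k + Complex.I * s
  H.nablaF D σ V + (1 / (2 * t)) • ⁅H.b L k σ V, D.1 σ⁆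
    - (1 / (2 * (starRingEnd ℂ) t)) • ⁅H.bbar L k σ V, D.1 σ⁆

/-- The coefficient of `s^{-l}`, `l ≥ 1`, of the formal Hitchin-Witten connection:
`D ↦ -((ik)^l / 2k) [b(V) - (-1)^l b̄(V), D]`. -/
noncomputable def formalCoeff (l : ℕ) (σ : T) (V : TangentSpace 𝓘(ℝ, ET) σ) (D : L.Op k) : L.Op k :=
  (-(Complex.I * k) ^ l / (2 * k)) • ⁅H.b L k σ V - (-1 : ℂ) ^ l • H.bbar L k σ V, D⁆

/-- The covariant derivative of the formal power series `∑ S^{(l)} s^{-l}`, with respect to the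
formal Hitchin-Witten connection `∇^F + ∑_{l ≥ 1} (formalCoeff l) s^{-l}`, as a formal power series
in `s^{-1}`. -/
noncomputable def formalDeriv (S : ℕ → L.OpFamily k ET T) (σ : T) (V : TangentSpace 𝓘(ℝ, ET) σ) :
    PowerSeries (L.Op k) :=
  PowerSeries.mk fun l => H.nablaF (S l) σ V
    + ∑ m ∈ Finset.Icc 1 l, H.formalCoeff m σ V ((S (l - m)).1 σ)

/-- The formal power series is covariantly constant. -/
def FormallyConstant (S : ℕ → L.OpFamily k ET T) : Prop :=
  ∀ (σ : T) (V : TangentSpace 𝓘(ℝ, ET) σ), H.formalDeriv S σ V = 0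

end HitchinWittenData

/-- The `N`-th truncation `∑_{l ≤ N} S^{(l)} s^{-l}`. -/
noncomputable def truncation {ι : Type*} {Ω : SymplecticForm n M} {L : PrequantumBundle ι Ω}
    {k : ℕ} (S : ℕ → L.OpFamily k ET T) (N : ℕ) (s : ℝ) : L.OpFamily k ET T :=
  ∑ l ∈ Finset.range (N + 1), ((s : ℂ)⁻¹ ^ l) • S l

/-- `A(s) = o(s^{-N})` along the filter `l`, measured by the `[0, ∞]`-valued function `p`. -/
def DecaysFasterThan {α : Type*} (p : α → ENNReal) (l : Filter ℝ) (N : ℕ) (A : ℝ → α) : Prop :=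
  Filter.Tendsto (fun s => ENNReal.ofReal (|s| ^ N) * p (A s)) l (𝓝 0)

/-- The asymptotic requirement that, for every tangent vector `V` at `σ ∈ T` and every positive
integer `N`, the Hitchin-Witten covariant derivative of the `N`-th truncation of the series is
`o(s^{-N})` with respect to `p σ`. -/
def HitchinWittenData.AsymptoticallyConstant {ι : Type*} {Ω : SymplecticForm n M}
    {L : PrequantumBundle ι Ω} {k : ℕ} (H : HitchinWittenData ET T Ω)
    (S : ℕ → L.OpFamily k ET T) (l : Filter ℝ) (p : T → L.Op k → ENNReal) : Prop :=
  ∀ (σ : T) (V : TangentSpace 𝓘(ℝ, ET) σ) (N : ℕ), 1 ≤ N →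
    DecaysFasterThan (p σ) l N fun s => H.hwDeriv s (truncation S N s) σ V

section Norm
variable [T2Space M] [SigmaCompactSpace M]

variable (n M) in
/-- A partition of unity subordinate to the charts. -/
noncomputable def chartPartition : SmoothPartitionOfUnity M (𝓡 n) M univ :=
  (SmoothPartitionOfUnity.exists_isSubordinate_chartAt_source (𝓡 n) M).choose

/-- The density of the Liouville measure `ω^m / m!` in the coordinates of the chart at `c`:
the square root of the determinant of the matrix of `ω`. -/
noncomputable def liouvilleDensity (Ω : SymplecticForm n M) (c x : M) : ℝ :=
  Real.sqrt |(Matrix.of fun i j : Fin n => Ω.form x (frameAt c x (EuclideanSpace.single i 1))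
    (frameAt c x (EuclideanSpace.single j 1))).det|

/-- The `L²` norm, in `[0, ∞]`, of a section, with respect to the Hermitian structure and the
Liouville measure. The local frames are unitary, so that `‖ψ x‖` is the norm in the fibre. -/
noncomputable def l2norm (Ω : SymplecticForm n M) (ψ : M → ℂ) : ENNReal :=
  (∑' c : M, ∫⁻ y in (chartAt (Rn n) c).target,
    ENNReal.ofReal (chartPartition n M c ((chartAt (Rn n) c).symm y))
      * ‖ψ ((chartAt (Rn n) c).symm y)‖ₑ ^ 2
      * ENNReal.ofReal (liouvilleDensity Ω c ((chartAt (Rn n) c).symm y))) ^ (1 / 2 : ℝ)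
end Norm

/-- A seminorm with values in `[0, ∞]`. -/
structure IsExtSeminorm {A : Type*} [AddCommGroup A] [Module ℂ A] (p : A → ENNReal) : Prop where
  add_le : ∀ a b, p (a + b) ≤ p a + p b
  smul : ∀ (c : ℂ) a, p (c • a) = ‖c‖ₑ * p a

end Geometry

/-! Write `X l`, `B l`, `C l` for the operators `∇^F_V S^{(l)}`, `[b(V), S^{(l)}]`, `[b̄(V),
S^{(l)}]` at a fixed σ and V, and t = k + is. The identity 1/(2t) = s⁻¹(-i/2 + ik/(2t)), together
with its conjugate, generates the geometric expansions -(1/2k) ∑ (ik)^m s^{-m} of 1/(2t) and (1/2k)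
∑ (-ik)^m s^{-m} of -1/(2t̄), the sums running over m ≥ 1. Their combined coefficients are those of
the formal Hitchin–Witten connection (`coeff_formalDeriv_succ`).

Applied to the truncation at level N, this gives an exact identity (`sum_truncation_eq`): the
derivative equals ∑_{l ≤ N} s^{-l} R_l + s^{-N} ((1/2t) P_N - (1/2t̄) Q_N). Here R_l are the
coefficients of the formal derivative, and P_N, Q_N are finite sums that do not depend on s. The
remainder is a combination of two fixed operators with scalar coefficients tending to 0, so any
seminorm finite on these operators makes it o(s^{-N}); no topology on operators and no uniform
estimate is involved.

If all R_l vanish, only this remainder is left. Conversely, if R_0, …, R_{m-1} vanish, the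
requirement at level N = m + 1, multiplied by s^m, makes R_m null for every seminorm, hence zero by
separation; this is the induction in `forall_decaysFasterThan_iff`. The second claim follows at
once.

For the L² claim the seminorms are A ↦ ‖Aψ‖ with ψ compactly supported. They need not be finite on,
or separate, arbitrary operators. The operators in question are local, however: finite-order
operators are local (`HasOrderLT.isLocal`), and so are b, b̄ and derivatives of families. A local
operator preserves compact support, which gives finiteness (`l2norm_ne_top`), and it is determined
by its values on compactly supported sections (`IsLocal.eq_zero`). With the definiteness of the L²
norm on smooth sections (`eq_zero_of_l2norm_eq_zero`), this gives separation. -/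

section FormalExpansion

/-! ### Geometric expansion of 1/(2t) and 1/(2t̄) in powers of 1/s -/

variable {E : Type*} [AddCommGroup E] [Module ℂ E]

/-- The coefficients of the product of the geometric series in `z` and a formal series `B`. -/
noncomputable def geomConv (z : ℂ) (B : ℕ → E) (N : ℕ) : E :=
  ∑ m ∈ Finset.range (N + 1), z ^ m • B (N - m)

theorem geomConv_zero (z : ℂ) (B : ℕ → E) : geomConv z B 0 = B 0 := by
  simp [geomConv]

/-- Horner's recursion: the geometric series G in z satisfies G = 1 + z s⁻¹ G. It drives the
induction on the truncation level. -/
theorem geomConv_succ (z : ℂ) (B : ℕ → E) (N : ℕ) :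
    geomConv z B (N + 1) = z • geomConv z B N + B (N + 1) := by
  rw [geomConv, Finset.sum_range_succ', geomConv, Finset.smul_sum]
  congr 1
  · refine Finset.sum_congr rfl fun m _ => ?_
    rw [smul_smul, pow_succ', Nat.add_sub_add_right]
  · simp

/-- The formal connection starts at m = 1 while the geometric series starts at m = 0; the shift
releases one factor z. -/
theorem sum_Icc_eq_geomConv (a z : ℂ) (B : ℕ → E) (N : ℕ) :
    ∑ m ∈ Finset.Icc 1 (N + 1), (a * z ^ m) • B (N + 1 - m) = (a * z) • geomConv z B N := by
  rw [geomConv, Finset.smul_sum, ← Finset.Ico_succ_right_eq_Icc, Finset.sum_Ico_eq_sum_range]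
  refine Finset.sum_congr (by simp) fun m _ => ?_
  rw [smul_smul, show N + 1 - (1 + m) = N - m by omega]
  congr 1
  ring

/-- The expansion in powers of `s⁻¹` of a truncated series acted upon by
`X + (1/2t) B - (1/2t̄) C`. -/
theorem sum_truncation_eq {k : ℕ} {s : ℝ} (hs : s ≠ 0) {X B C R : ℕ → E}
    (h0 : R 0 = X 0)
    (hR : ∀ N, R (N + 1) = X (N + 1) - (Complex.I / 2) • (geomConv (Complex.I * k) B N
      + geomConv (-(Complex.I * k)) C N)) (N : ℕ) :
    ∑ l ∈ Finset.range (N + 1), ((s : ℂ)⁻¹ ^ l) • (X l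
        + (1 / (2 * (k + Complex.I * s)) : ℂ) • B l - (1 / (2 * (k - Complex.I * s)) : ℂ) • C l)
      = ∑ l ∈ Finset.range (N + 1), ((s : ℂ)⁻¹ ^ l) • R l
        + ((s : ℂ)⁻¹ ^ N) • ((1 / (2 * (k + Complex.I * s)) : ℂ) • geomConv (Complex.I * k) B N
          - (1 / (2 * (k - Complex.I * s)) : ℂ) • geomConv (-(Complex.I * k)) C N) := by
  have hs' : (s : ℂ) ≠ 0 := by exact_mod_cast hs
  -- The imaginary part of t is s.
  have h1 : (k + Complex.I * s : ℂ) ≠ 0 := fun h => hs (by simpa using congrArg Complex.im h)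
  have h2 : (k - Complex.I * s : ℂ) ≠ 0 := fun h => hs (by simpa using congrArg Complex.im h)
  -- One step of the geometric expansion: -it + ik = s. Each use extracts one exact coefficient and
  -- keeps the rest as a multiple of 1/(2t).
  have e1 : (1 / (2 * (k + Complex.I * s)) : ℂ)
      = (s : ℂ)⁻¹ * (-(Complex.I / 2) + (1 / (2 * (k + Complex.I * s))) * (Complex.I * k)) := by
    field_simp
    ring_nf
    simp only [Complex.I_sq]
    ring
  have e2 : (1 / (2 * (k - Complex.I * s)) : ℂ)
      = (s : ℂ)⁻¹ * (Complex.I / 2 + (1 / (2 * (k - Complex.I * s))) * (-(Complex.I * k))) := by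
    field_simp
    ring_nf
    simp only [Complex.I_sq]
    ring
  induction N with
  | zero => simp [geomConv_zero, h0, add_sub_assoc]
  | succ N ih =>
    rw [Finset.sum_range_succ, ih, Finset.sum_range_succ _ (N + 1), hR, geomConv_succ, geomConv_succ]
    generalize (1 / (2 * (k + Complex.I * s)) : ℂ) = α at *
    generalize (1 / (2 * (k - Complex.I * s)) : ℂ) = β at *
    -- The remainder at level N is rewritten at level N + 1. Its ∓i/2 parts supply the missing terms
    -- of `R (N + 1)`, and the multiples of ±ik extend `geomConv` by one step.
    have e3 : ((s : ℂ)⁻¹ ^ N) • (α • geomConv (Complex.I * k) B N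
          - β • geomConv (-(Complex.I * k)) C N)
        = ((s : ℂ)⁻¹ ^ (N + 1)) • ((-(Complex.I / 2) + α * (Complex.I * k)) • geomConv (Complex.I * k) B N
          - (Complex.I / 2 + β * (-(Complex.I * k))) • geomConv (-(Complex.I * k)) C N) := by
      conv_lhs => rw [e1, e2]
      simp only [smul_sub, smul_smul, pow_succ, mul_assoc]
    rw [e3]
    module

end FormalExpansion

/-! ### Extended seminorms and comparison of coefficients -/

section Seminorms

variable {E : Type*} [AddCommGroup E] [Module ℂ E] {p : E → ENNReal}

/-- Homogeneity with c = 0 suffices, even for infinite values, because 0 · ∞ = 0 in `ENNReal`. -/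
theorem IsExtSeminorm.map_zero (hp : IsExtSeminorm p) : p 0 = 0 := by
  simpa using hp.smul 0 0

theorem IsExtSeminorm.neg (hp : IsExtSeminorm p) (a : E) : p (-a) = p a := by
  simpa using hp.smul (-1) a

theorem IsExtSeminorm.sub_le (hp : IsExtSeminorm p) (a b : E) : p (a - b) ≤ p a + p b := by
  simpa [sub_eq_add_neg, hp.neg] using hp.add_le a (-b)

theorem IsExtSeminorm.smul_ne_top (hp : IsExtSeminorm p) (c : ℂ) {a : E} (ha : p a ≠ ⊤) :
    p (c • a) ≠ ⊤ := by
  rw [hp.smul]; exact ENNReal.mul_ne_top (by simp) ha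

theorem IsExtSeminorm.add_ne_top (hp : IsExtSeminorm p) {a b : E} (ha : p a ≠ ⊤) (hb : p b ≠ ⊤) :
    p (a + b) ≠ ⊤ :=
  ne_top_of_le_ne_top (ENNReal.add_ne_top.2 ⟨ha, hb⟩) (hp.add_le a b)

theorem IsExtSeminorm.sub_ne_top (hp : IsExtSeminorm p) {a b : E} (ha : p a ≠ ⊤) (hb : p b ≠ ⊤) :
    p (a - b) ≠ ⊤ :=
  ne_top_of_le_ne_top (ENNReal.add_ne_top.2 ⟨ha, hb⟩) (hp.sub_le a b)

theorem IsExtSeminorm.sum_ne_top (hp : IsExtSeminorm p) {ι : Type*} {t : Finset ι} {a : ι → E}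
    (h : ∀ i ∈ t, p (a i) ≠ ⊤) : p (∑ i ∈ t, a i) ≠ ⊤ := by
  classical
  induction t using Finset.induction_on with
  | empty => simp [hp.map_zero]
  | insert i t hi ih =>
    rw [Finset.sum_insert hi]
    exact hp.add_ne_top (h i (by simp)) (ih fun j hj => h j (by simp [hj]))

theorem IsExtSeminorm.geomConv_ne_top (hp : IsExtSeminorm p) (z : ℂ) {B : ℕ → E}
    (h : ∀ m, p (B m) ≠ ⊤) (N : ℕ) : p (geomConv z B N) ≠ ⊤ :=
  hp.sum_ne_top fun _ _ => hp.smul_ne_top _ (h _)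

/-- A combination of fixed vectors with coefficients that tend to zero tends to zero. -/
theorem IsExtSeminorm.tendsto_smul_sub_smul (hp : IsExtSeminorm p) {α : Type*} {l : Filter α}
    {f g : α → ℂ} (hf : Filter.Tendsto f l (𝓝 0)) (hg : Filter.Tendsto g l (𝓝 0)) {P Q : E}
    (hP : p P ≠ ⊤) (hQ : p Q ≠ ⊤) :
    Filter.Tendsto (fun s => p (f s • P - g s • Q)) l (𝓝 0) := by
  have key : ∀ {f : α → ℂ} {P : E}, Filter.Tendsto f l (𝓝 0) → p P ≠ ⊤ →
      Filter.Tendsto (fun s => ‖f s‖ₑ * p P) l (𝓝 0) := by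
    intro f P hf hP
    have h1 : Filter.Tendsto (fun s => ‖f s‖ₑ) l (𝓝 0) := by
      simpa [Function.comp_def] using (continuous_enorm.tendsto (0 : ℂ)).comp hf
    -- Finiteness of `p P` is essential: multiplication by ∞ is not continuous at 0.
    simpa using ENNReal.Tendsto.mul_const h1 (Or.inr hP)
  have h := (key hf hP).add (key hg hQ)
  rw [add_zero] at h
  refine tendsto_of_tendsto_of_tendsto_of_le_of_le tendsto_const_nhds h (fun _ => zero_le) fun s => ?_
  refine (hp.sub_le _ _).trans ?_
  rw [hp.smul, hp.smul]

theorem tendsto_ofReal_inv {l : Filter ℝ} (hl : l ≤ Bornology.cobounded ℝ) :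
    Filter.Tendsto (fun s : ℝ => (s : ℂ)⁻¹) l (𝓝 0) := by
  have h : Filter.Tendsto (fun s : ℝ => s⁻¹) l (𝓝 0) := Filter.tendsto_inv₀_cobounded.mono_left hl
  have := (Complex.continuous_ofReal.tendsto 0).comp h
  simpa [Function.comp_def] using this

theorem eventually_ne_zero_of_le_cobounded {l : Filter ℝ} (hl : l ≤ Bornology.cobounded ℝ) :
    ∀ᶠ s in l, s ≠ 0 :=
  hl (Bornology.eventually_ne_cobounded 0)

theorem tendsto_level_inv {l : Filter ℝ} (hl : l ≤ Bornology.cobounded ℝ) {t : ℝ → ℂ}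
    (ht : ∀ s, |s| ≤ ‖t s‖) : Filter.Tendsto (fun s => 1 / (2 * t s)) l (𝓝 0) := by
  have h : Filter.Tendsto (fun s => 2 * t s) l (Bornology.cobounded ℂ) := by
    rw [← tendsto_norm_atTop_iff_cobounded]
    have h1 : Filter.Tendsto (fun s : ℝ => |s|) l Filter.atTop :=
      tendsto_norm_cobounded_atTop.mono_left hl
    refine Filter.tendsto_atTop_mono (fun s => ?_) h1
    rw [norm_mul, Complex.norm_ofNat]
    linarith [ht s, abs_nonneg s]
  simpa [Function.comp_def] using Filter.tendsto_inv₀_cobounded.comp h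

theorem tendsto_level {l : Filter ℝ} (hl : l ≤ Bornology.cobounded ℝ) (k : ℕ) :
    Filter.Tendsto (fun s : ℝ => (1 / (2 * (k + Complex.I * s)) : ℂ)) l (𝓝 0) :=
  tendsto_level_inv hl fun s => by
    simpa using Complex.abs_im_le_norm (k + Complex.I * s)

theorem tendsto_level_conj {l : Filter ℝ} (hl : l ≤ Bornology.cobounded ℝ) (k : ℕ) :
    Filter.Tendsto (fun s : ℝ => (1 / (2 * (k - Complex.I * s)) : ℂ)) l (𝓝 0) :=
  tendsto_level_inv hl fun s => by
    simpa using Complex.abs_im_le_norm (k - Complex.I * s)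

/-- Moves the weight of the decay condition inside the seminorm, where it cancels the powers of s⁻¹
algebraically. -/
theorem IsExtSeminorm.ofReal_abs_pow_mul (hp : IsExtSeminorm p) (s : ℝ) (N : ℕ) (a : E) :
    ENNReal.ofReal (|s| ^ N) * p a = p ((s : ℂ) ^ N • a) := by
  rw [hp.smul, ← ofReal_norm, norm_pow, Complex.norm_real, Real.norm_eq_abs]

/-- If all coefficients vanish, the truncations decay. -/
theorem IsExtSeminorm.decaysFasterThan (hp : IsExtSeminorm p) {l : Filter ℝ}
    (hl : l ≤ Bornology.cobounded ℝ) {f g : ℝ → ℂ} (hf : Filter.Tendsto f l (𝓝 0))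
    (hg : Filter.Tendsto g l (𝓝 0)) {P Q : E} (hP : p P ≠ ⊤) (hQ : p Q ≠ ⊤) {N : ℕ} {A : ℝ → E}
    (hA : ∀ s ≠ 0, A s = ((s : ℂ)⁻¹ ^ N) • (f s • P - g s • Q)) : DecaysFasterThan p l N A := by
  refine (hp.tendsto_smul_sub_smul hf hg hP hQ).congr' ?_
  filter_upwards [eventually_ne_zero_of_le_cobounded hl] with s hs
  rw [hA s hs, hp.ofReal_abs_pow_mul, smul_smul, ← mul_pow, mul_inv_cancel₀ (by exact_mod_cast hs),
    one_pow, one_smul]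

/-- The leading coefficient of a series that decays faster than its leading power is null. -/
theorem IsExtSeminorm.eq_zero_of_decaysFasterThan (hp : IsExtSeminorm p) {l : Filter ℝ} [l.NeBot]
    (hl : l ≤ Bornology.cobounded ℝ) {f g : ℝ → ℂ} (hf : Filter.Tendsto f l (𝓝 0))
    (hg : Filter.Tendsto g l (𝓝 0)) {P Q R R' : E} (hP : p P ≠ ⊤) (hQ : p Q ≠ ⊤)
    (hR' : p R' ≠ ⊤) {m : ℕ} {A : ℝ → E}
    (hA : ∀ s ≠ 0, A s = ((s : ℂ)⁻¹ ^ m) • R + ((s : ℂ)⁻¹ ^ (m + 1)) • R'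
      + ((s : ℂ)⁻¹ ^ (m + 1)) • (f s • P - g s • Q))
    (h : DecaysFasterThan p l (m + 1) A) : p R = 0 := by
  have hi := tendsto_ofReal_inv hl
  have h0 : p (0 : E) ≠ ⊤ := by simp [hp.map_zero]
  have t1 : Filter.Tendsto (fun s : ℝ => p ((s : ℂ)⁻¹ • R')) l (𝓝 0) := by
    simpa using hp.tendsto_smul_sub_smul hi hi hR' h0
  have t2 := hp.tendsto_smul_sub_smul (hi.mul hf |>.trans_eq (by simp))
    (hi.mul hg |>.trans_eq (by simp)) hP hQ
  -- The hypothesis controls s^{m+1} A, but isolating R takes only s^m A; hence the extra factor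
  -- s⁻¹.
  have t3 : Filter.Tendsto (fun s : ℝ => ‖(s : ℂ)⁻¹‖ₑ * (ENNReal.ofReal (|s| ^ (m + 1)) * p (A s))) l
      (𝓝 0) := by
    have h1 : Filter.Tendsto (fun s : ℝ => ‖(s : ℂ)⁻¹‖ₑ) l (𝓝 0) := by
      simpa [Function.comp_def] using (continuous_enorm.tendsto (0 : ℂ)).comp hi
    simpa using ENNReal.Tendsto.mul h1 (by simp) h (by simp)
  have t := (t3.add t1).add t2
  simp only [add_zero] at t
  refine le_antisymm (ge_of_tendsto t ?_) zero_le
  filter_upwards [eventually_ne_zero_of_le_cobounded hl] with s hs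
  have hs' : (s : ℂ) ≠ 0 := by exact_mod_cast hs
  -- The expansion solved for R. The seminorm of each of the three terms on the right tends to 0,
  -- whereas the left side does not depend on s.
  have e : R = (s : ℂ)⁻¹ • (s : ℂ) ^ (m + 1) • A s - (s : ℂ)⁻¹ • R'
      - (((s : ℂ)⁻¹ * f s) • P - ((s : ℂ)⁻¹ * g s) • Q) := by
    have c : ∀ v : E, (s : ℂ) ^ (m + 1) • (s : ℂ)⁻¹ ^ (m + 1) • v = v := fun v => by
      rw [smul_smul, ← mul_pow, mul_inv_cancel₀ hs', one_pow, one_smul]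
    have c' : ∀ v : E, (s : ℂ) ^ (m + 1) • (s : ℂ)⁻¹ ^ m • v = (s : ℂ) • v := fun v => by
      rw [smul_smul, pow_succ', mul_assoc, ← mul_pow, mul_inv_cancel₀ hs', one_pow, mul_one]
    rw [hA s hs, smul_add ((s : ℂ) ^ (m + 1)), c, smul_add ((s : ℂ) ^ (m + 1)), c, c', smul_add,
      smul_add, inv_smul_smul₀ hs']
    module
  rw [hp.ofReal_abs_pow_mul, ← hp.smul]
  calc p R = _ := congrArg p e
    _ ≤ _ := hp.sub_le _ _
    _ ≤ _ := add_le_add_left (hp.sub_le _ _) _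

/-- Let `A N s` be the result of applying `X + (1/2t) B - (1/2t̄) C`, `t = k + is`, to the `N`-th
truncation of a formal series, and let `R` be the coefficients of the resulting formal series. Then
`A N s = o(s⁻ᴺ)` for all `N ≥ 1` if and only if all coefficients vanish, provided that the
seminorms separate the coefficients. -/
theorem forall_decaysFasterThan_iff {k : ℕ} {l : Filter ℝ} [l.NeBot]
    (hl : l ≤ Bornology.cobounded ℝ) {X B C R : ℕ → E} (h0 : R 0 = X 0)
    (hR : ∀ N, R (N + 1) = X (N + 1) - (Complex.I / 2) • (geomConv (Complex.I * k) B N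
      + geomConv (-(Complex.I * k)) C N)) {A : ℕ → ℝ → E}
    (hA : ∀ N s, A N s = ∑ l ∈ Finset.range (N + 1), ((s : ℂ)⁻¹ ^ l) • (X l
        + (1 / (2 * (k + Complex.I * s)) : ℂ) • B l - (1 / (2 * (k - Complex.I * s)) : ℂ) • C l))
    {α : Type*} {p : α → E → ENNReal} (hp : ∀ j, IsExtSeminorm (p j))
    (hfin : ∀ j m, p j (X m) ≠ ⊤ ∧ p j (B m) ≠ ⊤ ∧ p j (C m) ≠ ⊤)
    (hsep : ∀ m, (∀ j, p j (R m) = 0) → R m = 0) :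
    (∀ j N, 1 ≤ N → DecaysFasterThan (p j) l N (A N)) ↔ ∀ m, R m = 0 := by
  have hf := tendsto_level hl k
  have hg := tendsto_level_conj hl k
  have hP : ∀ j N, p j (geomConv (Complex.I * k) B N) ≠ ⊤ := fun j =>
    (hp j).geomConv_ne_top _ fun m => (hfin j m).2.1
  have hQ : ∀ j N, p j (geomConv (-(Complex.I * k)) C N) ≠ ⊤ := fun j =>
    (hp j).geomConv_ne_top _ fun m => (hfin j m).2.2
  constructor
  · intro h m
    induction m using Nat.strong_induction_on with
    | _ m ih =>
      refine hsep m fun j => ?_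
      have hR' : p j (R (m + 1)) ≠ ⊤ := by
        rw [hR]
        exact (hp j).sub_ne_top (hfin j _).1 ((hp j).smul_ne_top _
          ((hp j).add_ne_top (hP j m) (hQ j m)))
      -- Level m + 1 rather than m is used, so that m = 0 is covered although only levels N ≥ 1 are
      -- assumed. The price is the additional term with `R (m + 1)`, which is harmless since it
      -- carries a further s⁻¹.
      refine (hp j).eq_zero_of_decaysFasterThan hl hf hg (hP j (m + 1)) (hQ j (m + 1)) hR'
        (fun s hs => ?_) (h j (m + 1) (by omega))
      rw [hA, sum_truncation_eq hs h0 hR, Finset.sum_range_succ, Finset.sum_range_succ,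
        Finset.sum_eq_zero fun i hi => by rw [ih i (Finset.mem_range.1 hi), smul_zero], zero_add]
  · intro h j N _
    refine (hp j).decaysFasterThan hl hf hg (hP j N) (hQ j N) fun s hs => ?_
    rw [hA, sum_truncation_eq hs h0 hR]
    simp [h]

end Seminorms

/-! ### The Hitchin–Witten derivative and the formal connection -/

section HitchinWitten
variable {n : ℕ} {M : Type*} [TopologicalSpace M] [ChartedSpace (Rn n) M]
  [IsManifold (𝓡 n) ∞ M]
variable {ET T : Type*} [NormedAddCommGroup ET] [NormedSpace ℂ ET]
  [TopologicalSpace T] [ChartedSpace ET T] [IsManifold 𝓘(ℂ, ET) ∞ T]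
variable {ι : Type*} {Ω : SymplecticForm n M} {L : PrequantumBundle ι Ω} {k : ℕ}

namespace PrequantumBundle

theorem OpFamily.deriv_add (A B : L.OpFamily k ET T) (σ : T) (V : TangentSpace 𝓘(ℝ, ET) σ) :
    OpFamily.deriv (A + B) σ V = OpFamily.deriv A σ V + OpFamily.deriv B σ V := by
  ext ψ x
  exact DFunLike.congr_fun
    (mvfderiv_fun_add (OpFamily.slice_mdiff' A ψ x σ) (OpFamily.slice_mdiff' B ψ x σ)) V

theorem OpFamily.deriv_smul (c : ℂ) (A : L.OpFamily k ET T) (σ : T)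
    (V : TangentSpace 𝓘(ℝ, ET) σ) : OpFamily.deriv (c • A) σ V = c • OpFamily.deriv A σ V := by
  ext ψ x
  exact mvfderiv_clm_comp (ContinuousLinearMap.mul ℝ ℂ c) (OpFamily.slice_mdiff' A ψ x σ) V

end PrequantumBundle

namespace HitchinWittenData
variable (H : HitchinWittenData ET T Ω)

theorem lie_sum_smul (b : L.Op k) {β : Type*} (t : Finset β) (c : β → ℂ)
    (D : β → L.Op k) : ⁅b, ∑ l ∈ t, c l • D l⁆ = ∑ l ∈ t, c l • ⁅b, D l⁆ := by
  simp only [Ring.lie_def, Finset.mul_sum, Finset.sum_mul, mul_smul_comm, smul_mul_assoc, smul_sub,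
    Finset.sum_sub_distrib]

theorem nablaF_add (A B : L.OpFamily k ET T) (σ : T) (V : TangentSpace 𝓘(ℝ, ET) σ) :
    H.nablaF (A + B) σ V = H.nablaF A σ V + H.nablaF B σ V := by
  simp only [nablaF, PrequantumBundle.OpFamily.deriv_add, Submodule.coe_add, Pi.add_apply,
    Ring.lie_def, mul_add, add_mul]
  abel

theorem nablaF_smul (c : ℂ) (A : L.OpFamily k ET T) (σ : T) (V : TangentSpace 𝓘(ℝ, ET) σ) :
    H.nablaF (c • A) σ V = c • H.nablaF A σ V := by
  simp only [nablaF, PrequantumBundle.OpFamily.deriv_smul, Submodule.coe_smul, Pi.smul_apply,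
    Ring.lie_def, mul_smul_comm, smul_mul_assoc, smul_sub, smul_add]

theorem nablaF_sum_smul {β : Type*} (t : Finset β) (c : β → ℂ) (S : β → L.OpFamily k ET T) (σ : T)
    (V : TangentSpace 𝓘(ℝ, ET) σ) :
    H.nablaF (∑ l ∈ t, c l • S l) σ V = ∑ l ∈ t, c l • H.nablaF (S l) σ V := by
  classical
  induction t using Finset.induction_on with
  -- Homogeneity with factor 0 gives the value 0 on the zero family.
  | empty => simpa using H.nablaF_smul 0 (0 : L.OpFamily k ET T) σ V
  | insert i t hi ih => rw [Finset.sum_insert hi, Finset.sum_insert hi, nablaF_add, nablaF_smul, ih]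

/-- The derivative is complex linear and the factors s^{-l} are constant along T, so it passes
through the finite sum. -/
theorem hwDeriv_truncation (S : ℕ → L.OpFamily k ET T) (N : ℕ) (s : ℝ) (σ : T)
    (V : TangentSpace 𝓘(ℝ, ET) σ) :
    H.hwDeriv s (truncation S N s) σ V = ∑ l ∈ Finset.range (N + 1), ((s : ℂ)⁻¹ ^ l) •
      (H.nablaF (S l) σ V + (1 / (2 * (k + Complex.I * s)) : ℂ) • ⁅H.b L k σ V, (S l).1 σ⁆
        - (1 / (2 * (k - Complex.I * s)) : ℂ) • ⁅H.bbar L k σ V, (S l).1 σ⁆) := by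
  have hc : (starRingEnd ℂ) (k + Complex.I * s) = k - Complex.I * s := by
    simp [sub_eq_add_neg]
  have hv : (truncation S N s).1 σ
      = ∑ l ∈ Finset.range (N + 1), ((s : ℂ)⁻¹ ^ l) • (S l).1 σ := by
    simp [truncation, Finset.sum_apply]
  simp only [hwDeriv, hc, hv, lie_sum_smul]
  rw [truncation, nablaF_sum_smul, Finset.smul_sum, Finset.smul_sum, ← Finset.sum_add_distrib,
    ← Finset.sum_sub_distrib]
  refine Finset.sum_congr rfl fun l _ => ?_
  rw [smul_comm _ ((s : ℂ)⁻¹ ^ l), smul_comm _ ((s : ℂ)⁻¹ ^ l), smul_sub, smul_add]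

theorem coeff_formalDeriv_zero (S : ℕ → L.OpFamily k ET T) (σ : T) (V : TangentSpace 𝓘(ℝ, ET) σ) :
    PowerSeries.coeff 0 (H.formalDeriv S σ V) = H.nablaF (S 0) σ V := by
  simp [formalDeriv, PowerSeries.coeff_mk]

/-- Identifies the formal connection with the geometric expansions of 1/(2t) and -1/(2t̄): since
(-1)^m (ik)^m = (-ik)^m, the b and b̄ parts are geometric with ratios ik and -ik. -/
theorem coeff_formalDeriv_succ (hk : 0 < k) (S : ℕ → L.OpFamily k ET T) (σ : T)
    (V : TangentSpace 𝓘(ℝ, ET) σ) (N : ℕ) :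
    PowerSeries.coeff (N + 1) (H.formalDeriv S σ V) = H.nablaF (S (N + 1)) σ V
      - (Complex.I / 2) • (geomConv (Complex.I * k) (fun l => ⁅H.b L k σ V, (S l).1 σ⁆) N
        + geomConv (-(Complex.I * k)) (fun l => ⁅H.bbar L k σ V, (S l).1 σ⁆) N) := by
  have hk' : (k : ℂ) ≠ 0 := by exact_mod_cast hk.ne'
  have hc : ∀ m (D : L.Op k), H.formalCoeff m σ V D
      = (-1 / (2 * k) * (Complex.I * k) ^ m : ℂ) • ⁅H.b L k σ V, D⁆
        - (-1 / (2 * k) * (-(Complex.I * k)) ^ m : ℂ) • ⁅H.bbar L k σ V, D⁆ := by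
    intro m D
    rw [neg_pow (Complex.I * (k : ℂ)) m]
    simp only [formalCoeff, Ring.lie_def, sub_mul, mul_sub, smul_mul_assoc, mul_smul_comm]
    module
  -- The factor ik released by the index shift cancels the k in the denominator; this is where k ≠ 0
  -- enters.
  have h1 : (-1 / (2 * k) * (Complex.I * k) : ℂ) = -(Complex.I / 2) := by field_simp
  have h2 : (-1 / (2 * k) * (-(Complex.I * k)) : ℂ) = Complex.I / 2 := by field_simp
  rw [formalDeriv, PowerSeries.coeff_mk]
  simp only [hc, Finset.sum_sub_distrib]
  rw [sum_Icc_eq_geomConv _ _ (fun l => ⁅H.b L k σ V, (S l).1 σ⁆),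
    sum_Icc_eq_geomConv _ _ (fun l => ⁅H.bbar L k σ V, (S l).1 σ⁆), h1, h2]
  module

/-- The asymptotic requirement for a family of seminorms that separates the coefficients is
equivalent to formal covariant constancy. -/
theorem forall_asymptoticallyConstant_iff (hk : 0 < k) (S : ℕ → L.OpFamily k ET T) {l : Filter ℝ}
    [l.NeBot] (hl : l ≤ Bornology.cobounded ℝ) {α : Type*} {p : α → T → L.Op k → ENNReal}
    (hp : ∀ j σ, IsExtSeminorm (p j σ))
    (hfin : ∀ j σ (V : TangentSpace 𝓘(ℝ, ET) σ) m, p j σ (H.nablaF (S m) σ V) ≠ ⊤ ∧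
      p j σ ⁅H.b L k σ V, (S m).1 σ⁆ ≠ ⊤ ∧ p j σ ⁅H.bbar L k σ V, (S m).1 σ⁆ ≠ ⊤)
    (hsep : ∀ σ (V : TangentSpace 𝓘(ℝ, ET) σ) m,
      (∀ j, p j σ (PowerSeries.coeff m (H.formalDeriv S σ V)) = 0) →
        PowerSeries.coeff m (H.formalDeriv S σ V) = 0) :
    (∀ j, H.AsymptoticallyConstant S l (p j)) ↔ H.FormallyConstant S := by
  -- The equivalence is purely pointwise in σ and V.
  have key := fun (σ : T) (V : TangentSpace 𝓘(ℝ, ET) σ) =>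
    forall_decaysFasterThan_iff (k := k) hl (H.coeff_formalDeriv_zero S σ V)
      (H.coeff_formalDeriv_succ hk S σ V) (fun N s => H.hwDeriv_truncation S N s σ V)
      (fun j => hp j σ) (fun j m => hfin j σ V m) (hsep σ V)
  constructor
  · intro h σ V
    ext1 m
    rw [map_zero]
    exact (key σ V).1 (fun j => h j σ V) m
  · intro h j σ V
    refine (key σ V).2 (fun m => ?_) j
    rw [h σ V, map_zero]

end HitchinWittenData
end HitchinWitten

/-! ### Locality of differential operators -/

section Locality
variable {n : ℕ} {M : Type*} [TopologicalSpace M] [ChartedSpace (Rn n) M]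
  [IsManifold (𝓡 n) ∞ M]

/-- A complex-valued smooth cutoff function. -/
theorem exists_smooth_cutoff [T2Space M] {s : Set M} {x : M} (hs : s ∈ 𝓝 x) :
    ∃ f : M → ℂ, (∀ y, ContMDiffAt (𝓡 n) 𝓘(ℝ, ℂ) ∞ f y) ∧ HasCompactSupport f ∧
      tsupport f ⊆ s ∧ f =ᶠ[𝓝 x] 1 := by
  obtain ⟨f, -, hf⟩ := (SmoothBumpFunction.nhds_basis_tsupport (I := 𝓡 n) x).mem_iff.1 hs
  have hsup : tsupport (fun y => (f y : ℂ)) = tsupport f := by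
    unfold tsupport
    congr 1
    ext y
    simp
  refine ⟨fun y => (f y : ℂ), fun y => Complex.ofRealCLM.contMDiff.contMDiffAt.comp y f.contMDiffAt,
    ?_, hsup ▸ hf, ?_⟩
  · unfold HasCompactSupport
    rw [hsup]
    exact f.hasCompactSupport
  · filter_upwards [f.eventuallyEq_one] with y hy
    simp [hy]

namespace PrequantumBundle
variable {ι : Type*} {Ω : SymplecticForm n M} {L : PrequantumBundle ι Ω} {k : ℕ}

theorem mulOp_apply (f : M → ℂ) (hf : ∀ x, ContMDiffAt (𝓡 n) 𝓘(ℝ, ℂ) ∞ f x) (ψ : L.Sec k) (x : M) :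
    (L.mulOp k f hf ψ : L.Sec k).1 x = f x * ψ.1 x :=
  congrArg (f x * ·) (L.rep_indexAt k ψ x)

/-- An operator on sections is local if the value of `A ψ` at `x` only depends on the germ of `ψ`
at `x`. -/
def IsLocal (A : L.Op k) : Prop :=
  ∀ (ψ : L.Sec k) (x : M), (ψ : M → ℂ) =ᶠ[𝓝 x] 0 → (A ψ : L.Sec k).1 x = 0

theorem IsLocal.eventuallyEq_zero {A : L.Op k} (hA : IsLocal A) {ψ : L.Sec k} {x : M}
    (h : (ψ : M → ℂ) =ᶠ[𝓝 x] 0) : ((A ψ : L.Sec k) : M → ℂ) =ᶠ[𝓝 x] 0 :=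
  h.eventuallyEq_nhds.mono fun y hy => hA ψ y hy

theorem isLocal_zero : IsLocal (0 : L.Op k) := fun _ _ _ => rfl

theorem IsLocal.add {A B : L.Op k} (hA : IsLocal A) (hB : IsLocal B) : IsLocal (A + B) :=
  fun ψ x h => by
    change (A ψ : L.Sec k).1 x + (B ψ : L.Sec k).1 x = 0
    rw [hA ψ x h, hB ψ x h, add_zero]

theorem IsLocal.smul {A : L.Op k} (hA : IsLocal A) (c : ℂ) : IsLocal (c • A) :=
  fun ψ x h => by
    change c * (A ψ : L.Sec k).1 x = 0
    rw [hA ψ x h, mul_zero]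

theorem IsLocal.sub {A B : L.Op k} (hA : IsLocal A) (hB : IsLocal B) : IsLocal (A - B) :=
  fun ψ x h => by
    change (A ψ : L.Sec k).1 x - (B ψ : L.Sec k).1 x = 0
    rw [hA ψ x h, hB ψ x h, sub_zero]

theorem IsLocal.mul {A B : L.Op k} (hA : IsLocal A) (hB : IsLocal B) : IsLocal (A * B) :=
  fun _ x h => hA _ x (hB.eventuallyEq_zero h)

theorem IsLocal.lie {A B : L.Op k} (hA : IsLocal A) (hB : IsLocal B) : IsLocal ⁅A, B⁆ := by
  rw [Ring.lie_def]
  exact (hA.mul hB).sub (hB.mul hA)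

theorem IsLocal.sum {β : Type*} {t : Finset β} {A : β → L.Op k} (h : ∀ i ∈ t, IsLocal (A i)) :
    IsLocal (∑ i ∈ t, A i) := by
  classical
  induction t using Finset.induction_on with
  | empty => simpa using isLocal_zero
  | insert i t hi ih =>
    rw [Finset.sum_insert hi]
    exact (h i (by simp)).add (ih fun j hj => h j (by simp [hj]))

theorem rep_eventuallyEq_zero {ψ : M → ℂ} {x : M} (h : ψ =ᶠ[𝓝 x] 0) (i : ι) :
    L.rep k i ψ =ᶠ[𝓝 x] fun _ => 0 :=
  h.mono fun y hy => by simp [rep, hy]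

theorem isLocal_mulOp (f : M → ℂ) (hf : ∀ x, ContMDiffAt (𝓡 n) 𝓘(ℝ, ℂ) ∞ f x) :
    IsLocal (L.mulOp k f hf) := fun ψ x h => by
  rw [mulOp_apply, show ψ.1 x = 0 from h.self_of_nhds, mul_zero]

theorem isLocal_nablaOp (X : ∀ x : M, TangentSpace (𝓡 n) x) (hX : ∀ x, VFSmoothAt X x) :
    IsLocal (L.nablaOp k X hX) := fun ψ x h => by
  change L.covD k _ (L.rep k (L.indexAt x) ψ) x (X x) = 0
  rw [L.covD_congr k (rep_eventuallyEq_zero h _)]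
  simp [covD, mvfderiv_const]

/-- The local expression depends only on the germ (`lapLoc_congr`), so the value agrees with that on
the zero section, which linearity makes 0. -/
theorem isLocal_lapOp (D : SmoothConnection n M)
    {B : ∀ x : M, (TangentSpace (𝓡 n) x →L[ℝ] ℝ) →L[ℝ] TangentSpace (𝓡 n) x} (hB : BivSmooth B) :
    IsLocal (L.lapOp k D hB) := fun ψ x h => by
  have h0 : ((0 : L.Sec k) : M → ℂ) =ᶠ[𝓝 x] 0 := Filter.EventuallyEq.rfl
  have e : (L.lapOp k D hB ψ : L.Sec k).1 x = (L.lapOp k D hB 0 : L.Sec k).1 x :=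
    L.lapLoc_congr k D hB (L.mem_indexAt x) (ψ.2 _ x (L.mem_indexAt x))
      ((rep_eventuallyEq_zero h _).trans (rep_eventuallyEq_zero h0 _).symm)
  rw [e, map_zero]
  rfl

/-- Induction on the order through commutators. If ψ vanishes near x, take f equal to 1 near x and
supported where ψ = 0. Then fψ = 0, so [D, f]ψ = -f Dψ, whose value at x is -(Dψ)(x); the commutator
has lower order and is local by induction. -/
theorem HasOrderLT.isLocal [T2Space M] {N : ℕ} {D : L.Op k} (h : L.HasOrderLT k N D) :
    IsLocal D := by
  induction N generalizing D with
  | zero =>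
    have h0 : D = 0 := h
    rw [h0]; exact isLocal_zero
  | succ N ih =>
    intro ψ x hψ
    obtain ⟨f, hf, -, hs, h1⟩ := exists_smooth_cutoff (n := n) hψ
    have hz : L.mulOp k f hf ψ = 0 := by
      ext y
      rw [mulOp_apply]
      by_cases hy : y ∈ tsupport f
      · rw [show ψ.1 y = 0 from hs hy, mul_zero]; rfl
      · rw [image_eq_zero_of_notMem_tsupport hy, zero_mul]; rfl
    have e := ih (h f hf) ψ x hψ
    change (D (L.mulOp k f hf ψ) : L.Sec k).1 x - (L.mulOp k f hf (D ψ) : L.Sec k).1 x = 0 at e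
    rw [hz, map_zero, mulOp_apply, h1.self_of_nhds] at e
    simpa using e

/-- A local operator is determined by its values on compactly supported sections. -/
theorem IsLocal.eq_zero [T2Space M] {A : L.Op k} (hA : IsLocal A)
    (h : ∀ ψ : L.Sec k, HasCompactSupport (ψ : M → ℂ) → A ψ = 0) : A = 0 := by
  ext ψ x
  obtain ⟨f, hf, hc, -, h1⟩ := exists_smooth_cutoff (n := n) (Filter.univ_mem (f := 𝓝 x))
  have hcs : HasCompactSupport ((L.mulOp k f hf ψ : L.Sec k) : M → ℂ) := by
    have : ((L.mulOp k f hf ψ : L.Sec k) : M → ℂ) = f * ψ := funext (mulOp_apply f hf ψ)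
    rw [this]
    exact hc.mul_right
  -- With f = 1 near x, ψ and the compactly supported fψ have the same germ at x.
  have e := hA (ψ - L.mulOp k f hf ψ) x (by
    filter_upwards [h1] with y hy
    change ψ.1 y - (L.mulOp k f hf ψ : L.Sec k).1 y = 0
    rw [mulOp_apply, hy, Pi.one_apply, one_mul, sub_self])
  rw [map_sub, h _ hcs, sub_zero] at e
  exact e

theorem IsLocal.hasCompactSupport [T2Space M] {A : L.Op k} (hA : IsLocal A) {ψ : L.Sec k}
    (hψ : HasCompactSupport (ψ : M → ℂ)) : HasCompactSupport ((A ψ : L.Sec k) : M → ℂ) := by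
  refine hψ.mono' fun x hx => ?_
  by_contra hn
  exact hx (hA ψ x (notMem_tsupport_iff_eventuallyEq.1 hn))

variable {ET T : Type*} [NormedAddCommGroup ET] [NormedSpace ℂ ET]
  [TopologicalSpace T] [ChartedSpace ET T] [IsManifold 𝓘(ℂ, ET) ∞ T]

theorem OpFamily.isLocal [T2Space M] (D : L.OpFamily k ET T) (σ : T) : IsLocal (D.1 σ) :=
  let ⟨_, hN⟩ := D.2.1 σ
  HasOrderLT.isLocal hN

/-- Each operator of the family is local, so the function of τ being differentiated is identically
zero. -/
theorem OpFamily.isLocal_deriv [T2Space M] (D : L.OpFamily k ET T) (σ : T)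
    (V : TangentSpace 𝓘(ℝ, ET) σ) : IsLocal (OpFamily.deriv D σ V) := fun ψ x h => by
  change mvfderiv 𝓘(ℝ, ET) (fun τ => (D.1 τ ψ : L.Sec k).1 x) σ V = 0
  simp only [OpFamily.isLocal D _ ψ x h, mvfderiv_const, zero_apply]

end PrequantumBundle

namespace HitchinWittenData
open PrequantumBundle
variable {ET T : Type*} [NormedAddCommGroup ET] [NormedSpace ℂ ET]
  [TopologicalSpace T] [ChartedSpace ET T] [IsManifold 𝓘(ℂ, ET) ∞ T]
variable {ι : Type*} {Ω : SymplecticForm n M} (L : PrequantumBundle ι Ω) (k : ℕ)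
  (H : HitchinWittenData ET T Ω)

theorem isLocal_opRe (σ : T) (V : TangentSpace 𝓘(ℝ, ET) σ) : IsLocal (H.opRe L k σ V) :=
  (isLocal_lapOp _ _).add ((isLocal_nablaOp _ _).smul _)

theorem isLocal_opIm (σ : T) (V : TangentSpace 𝓘(ℝ, ET) σ) : IsLocal (H.opIm L k σ V) :=
  (isLocal_lapOp _ _).add ((isLocal_nablaOp _ _).smul _)

theorem isLocal_b (σ : T) (V : TangentSpace 𝓘(ℝ, ET) σ) : IsLocal (H.b L k σ V) :=
  ((H.isLocal_opRe L k σ V).add ((H.isLocal_opIm L k σ V).smul _)).sub ((isLocal_mulOp _ _).smul _)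

theorem isLocal_bbar (σ : T) (V : TangentSpace 𝓘(ℝ, ET) σ) : IsLocal (H.bbar L k σ V) :=
  ((H.isLocal_opRe L k σ V).sub ((H.isLocal_opIm L k σ V).smul _)).sub ((isLocal_mulOp _ _).smul _)

variable [T2Space M] {L k}

theorem isLocal_nablaF (D : L.OpFamily k ET T) (σ : T) (V : TangentSpace 𝓘(ℝ, ET) σ) :
    IsLocal (H.nablaF D σ V) :=
  (OpFamily.isLocal_deriv D σ V).add ((isLocal_mulOp _ _).lie (OpFamily.isLocal D σ))

theorem isLocal_formalCoeff (m : ℕ) (σ : T) (V : TangentSpace 𝓘(ℝ, ET) σ) {D : L.Op k}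
    (hD : IsLocal D) : IsLocal (H.formalCoeff m σ V D) :=
  (((H.isLocal_b L k σ V).sub ((H.isLocal_bbar L k σ V).smul _)).lie hD).smul _

theorem isLocal_coeff_formalDeriv (S : ℕ → L.OpFamily k ET T) (σ : T)
    (V : TangentSpace 𝓘(ℝ, ET) σ) (m : ℕ) :
    IsLocal (PowerSeries.coeff m (H.formalDeriv S σ V)) := by
  rw [formalDeriv, PowerSeries.coeff_mk]
  exact (H.isLocal_nablaF _ σ V).add
    (IsLocal.sum fun _ _ => H.isLocal_formalCoeff _ σ V (OpFamily.isLocal _ σ))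

end HitchinWittenData
end Locality

/-! ### The Liouville density and pointwise norms -/

section Density
variable {n : ℕ} {M : Type*} [TopologicalSpace M] [ChartedSpace (Rn n) M]
  [IsManifold (𝓡 n) ∞ M]

/-- Coordinate frames are smooth on the whole domain of the chart. -/
theorem continuousAt_coframe_frame {c x : M} (hx : x ∈ (chartAt (Rn n) c).source) (v : Rn n) :
    ContinuousAt (fun y => coframeAt x y (frameAt c y v)) x := by
  have h := (contMDiffAt_coordChangeL (n := ∞) (IB := 𝓡 n)
    (e := trivializationAt (Rn n) (TangentSpace (𝓡 n) : M → Type _) c)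
    (e' := trivializationAt (Rn n) (TangentSpace (𝓡 n) : M → Type _) x) (x := x)
    (mem_base_iff.2 hx) (mem_base_iff.2 (mem_chart_source _ x))).continuousAt
  have h2 := h.clm_apply (continuousAt_const (y := v))
  refine h2.congr ?_
  filter_upwards [chart_mem_nhds (n := n) x, (chartAt (Rn n) c).open_source.mem_nhds hx] with y h1 h2
  rw [ContinuousLinearEquiv.coe_coe, Trivialization.coordChangeL_apply _ _
    ⟨mem_base_iff.2 h2, mem_base_iff.2 h1⟩]
  unfold coframeAt frameAt
  rw [Trivialization.continuousLinearMapAt_apply, Trivialization.linearMapAt_apply, if_pos]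
  · rw [Trivialization.symmL_apply _ (mem_base_iff.2 h2)]
  · exact h1

/-- Smoothness of ω is known at x only in the frame of the chart at x, so the frame of the chart at
c is expressed through that one by the continuous change of frames. -/
theorem continuousOn_liouvilleDensity (Ω : SymplecticForm n M) (c : M) :
    ContinuousOn (liouvilleDensity Ω c) (chartAt (Rn n) c).source := by
  intro x hx
  refine ContinuousAt.continuousWithinAt (Real.continuous_sqrt.continuousAt.comp
    (continuous_abs.continuousAt.comp ?_))
  refine Continuous.continuousAt (f := Matrix.det) (Continuous.matrix_det continuous_id) |>.comp ?_
  refine continuousAt_pi.2 fun i => continuousAt_pi.2 fun j => ?_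
  have h := (((Ω.smooth x).continuousAt).clm_apply
    (continuousAt_coframe_frame hx (EuclideanSpace.single i 1))).clm_apply
    (continuousAt_coframe_frame hx (EuclideanSpace.single j 1))
  refine h.congr ?_
  filter_upwards [chart_mem_nhds (n := n) x] with y hy
  simp [frame_coframe hy]

/-- A vector in the left kernel of the matrix of ω would give a tangent vector in the radical of ω;
the frame is injective, so nondegeneracy forbids it. -/
theorem liouvilleDensity_pos (Ω : SymplecticForm n M) {c x : M}
    (hx : x ∈ (chartAt (Rn n) c).source) : 0 < liouvilleDensity Ω c x := by
  refine Real.sqrt_pos.2 (abs_pos.2 fun h => ?_)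
  obtain ⟨v, hv, h0⟩ := Matrix.exists_vecMul_eq_zero_iff.2 h
  apply hv
  have hw : WithLp.toLp 2 v = ∑ i, v i • (EuclideanSpace.single i 1 : Rn n) := by
    ext j
    simp [Pi.single_apply]
  have hu : frameAt c x (WithLp.toLp 2 v) = 0 := by
    refine Ω.nondegenerate x _ fun u => ?_
    have hu : u = ∑ j, (coframeAt c x u) j • frameAt c x (EuclideanSpace.single j 1) := by
      conv_lhs => rw [← frame_coframe hx u]
      simp only [← map_smul, ← map_sum]
      congr 1
      ext j
      simp [Pi.single_apply]
    rw [hu, map_sum]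
    refine Finset.sum_eq_zero fun j _ => ?_
    have := congrFun h0 j
    rw [map_smul, hw, map_sum, map_sum]
    simp only [Matrix.vecMul, dotProduct, Matrix.of_apply, Pi.zero_apply] at this
    simp [this]
  have := congrArg (coframeAt c x) hu
  rw [coframe_frame hx, map_zero] at this
  funext i
  exact congrArg (fun w : Rn n => w i) this

/-- The function ψ itself may jump where the selected frame changes; its norm does not, since
transition functions are unimodular. -/
theorem PrequantumBundle.continuous_norm_sec {ι : Type*} {Ω : SymplecticForm n M}
    {L : PrequantumBundle ι Ω} {k : ℕ} (ψ : L.Sec k) : Continuous fun x => ‖ψ.1 x‖ := by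
  refine continuous_iff_continuousAt.2 fun x => ?_
  have hi := L.mem_indexAt x
  refine ((ψ.2 _ x hi).continuousAt.norm).congr ?_
  filter_upwards [L.nhds_U hi] with y hy
  rw [rep, norm_mul, norm_pow, L.norm_tr _ _ _ hy (L.mem_indexAt y), one_pow, one_mul]

end Density

/-! ### Minkowski's inequality for sums and integrals -/

section Minkowski
open MeasureTheory

theorem rpow_half_tsum_add_sq_le {β : Type*} (a b : β → ENNReal) :
    (∑' c, (a c + b c) ^ 2) ^ (1 / 2 : ℝ)
      ≤ (∑' c, a c ^ 2) ^ (1 / 2 : ℝ) + (∑' c, b c ^ 2) ^ (1 / 2 : ℝ) := by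
  -- Sums become integrals for the counting measure; with the discrete σ-algebra every function is
  -- measurable.
  let _ : MeasurableSpace β := ⊤
  have h := ENNReal.lintegral_Lp_add_le (μ := Measure.count) (f := a) (g := b) (p := 2)
    (measurable_from_top.aemeasurable) (measurable_from_top.aemeasurable) (by norm_num)
  simpa [lintegral_count] using h

theorem rpow_half_lintegral_add_sq_le {α : Type*} [MeasurableSpace α] {μ : Measure α}
    {f g : α → ENNReal} (hf : AEMeasurable f μ) (hg : AEMeasurable g μ) :
    (∫⁻ y, (f y + g y) ^ 2 ∂μ) ^ (1 / 2 : ℝ)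
      ≤ (∫⁻ y, f y ^ 2 ∂μ) ^ (1 / 2 : ℝ) + (∫⁻ y, g y ^ 2 ∂μ) ^ (1 / 2 : ℝ) := by
  simpa using ENNReal.lintegral_Lp_add_le hf hg (p := 2) (by norm_num)

theorem rpow_half_sq (a : ENNReal) : (a ^ (1 / 2 : ℝ)) ^ 2 = a := by
  rw [← ENNReal.rpow_natCast, ← ENNReal.rpow_mul]
  simp

end Minkowski

/-! ### The L² norm as an extended seminorm on operators -/

section Norm
open MeasureTheory
variable {n : ℕ} {M : Type*} [TopologicalSpace M] [ChartedSpace (Rn n) M]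
  [IsManifold (𝓡 n) ∞ M] [T2Space M] [SigmaCompactSpace M] (Ω : SymplecticForm n M)

theorem chartPartition_isSubordinate :
    (chartPartition n M).IsSubordinate (fun x => (chartAt (Rn n) x).source) :=
  (SmoothPartitionOfUnity.exists_isSubordinate_chartAt_source (𝓡 n) M).choose_spec

/-- The product of the square root of the local density in the chart at `c` with the pointwise norm
of a section. -/
noncomputable def l2local (c : M) (ψ : M → ℂ) (y : Rn n) : ℝ :=
  Real.sqrt (chartPartition n M c ((chartAt (Rn n) c).symm y)
    * liouvilleDensity Ω c ((chartAt (Rn n) c).symm y)) * ‖ψ ((chartAt (Rn n) c).symm y)‖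

theorem l2local_nonneg (c : M) (ψ : M → ℂ) (y : Rn n) : 0 ≤ l2local Ω c ψ y := by
  unfold l2local; positivity

/-- With the weights absorbed into the square, the norm is the ℓ² norm over charts of local L²
norms, the form to which Minkowski's inequality applies. -/
theorem l2norm_eq (ψ : M → ℂ) : l2norm Ω ψ = (∑' c : M, ∫⁻ y in (chartAt (Rn n) c).target,
    ENNReal.ofReal (l2local Ω c ψ y) ^ 2) ^ (1 / 2 : ℝ) := by
  unfold l2norm
  congr 1
  refine tsum_congr fun c => lintegral_congr fun y => ?_
  have h1 := (chartPartition n M).nonneg c ((chartAt (Rn n) c).symm y)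
  have h2 : 0 ≤ liouvilleDensity Ω c ((chartAt (Rn n) c).symm y) := Real.sqrt_nonneg _
  rw [← ENNReal.ofReal_pow (l2local_nonneg Ω c ψ y), l2local, mul_pow,
    Real.sq_sqrt (mul_nonneg h1 h2), ENNReal.ofReal_mul (mul_nonneg h1 h2), ENNReal.ofReal_mul h1,
    ENNReal.ofReal_pow (norm_nonneg _), ofReal_norm]
  ring

variable {Ω}
variable {ι : Type*} {L : PrequantumBundle ι Ω} {k : ℕ}

theorem continuousOn_l2local (c : M) (ψ : L.Sec k) :
    ContinuousOn (l2local Ω c ψ) (chartAt (Rn n) c).target := by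
  have hs := (chartAt (Rn n) c).continuousOn_symm
  have h1 : ContinuousOn (fun y => chartPartition n M c ((chartAt (Rn n) c).symm y))
      (chartAt (Rn n) c).target :=
    ((chartPartition n M c).contMDiff.continuous).comp_continuousOn hs
  have h2 := (continuousOn_liouvilleDensity Ω c).comp hs fun y hy =>
    (chartAt (Rn n) c).map_target hy
  exact ((h1.mul h2).sqrt).mul
    ((PrequantumBundle.continuous_norm_sec ψ).comp_continuousOn hs)

theorem aemeasurable_l2local (c : M) (ψ : L.Sec k) :
    AEMeasurable (fun y => ENNReal.ofReal (l2local Ω c ψ y))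
      (volume.restrict (chartAt (Rn n) c).target) :=
  ((continuousOn_l2local c ψ).aemeasurable
    (chartAt (Rn n) c).open_target.measurableSet).ennreal_ofReal

/-- Minkowski's inequality twice, over the charts and inside each chart, starting from pointwise
subadditivity of `l2local`. -/
theorem l2norm_add_le (ψ φ : L.Sec k) :
    l2norm Ω ((ψ + φ : L.Sec k) : M → ℂ) ≤ l2norm Ω ψ + l2norm Ω φ := by
  have key : ∀ χ : L.Sec k, l2norm Ω χ = (∑' c : M, ((∫⁻ y in (chartAt (Rn n) c).target,
      ENNReal.ofReal (l2local Ω c χ y) ^ 2) ^ (1 / 2 : ℝ)) ^ 2) ^ (1 / 2 : ℝ) := fun χ => by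
    rw [l2norm_eq]
    simp only [rpow_half_sq]
  rw [key, key, key]
  refine le_trans ?_ (rpow_half_tsum_add_sq_le _ _)
  gcongr with c
  refine le_trans ?_ (rpow_half_lintegral_add_sq_le (aemeasurable_l2local c ψ)
    (aemeasurable_l2local c φ))
  gcongr with y
  rw [← ENNReal.ofReal_add (l2local_nonneg Ω c _ y) (l2local_nonneg Ω c _ y)]
  refine ENNReal.ofReal_le_ofReal ?_
  unfold l2local
  rw [← mul_add]
  exact mul_le_mul_of_nonneg_left (norm_add_le _ _) (Real.sqrt_nonneg _)

theorem l2norm_smul (a : ℂ) (ψ : L.Sec k) :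
    l2norm Ω ((a • ψ : L.Sec k) : M → ℂ) = ‖a‖ₑ * l2norm Ω ψ := by
  have h : ∀ c y, ENNReal.ofReal (l2local Ω c ((a • ψ : L.Sec k) : M → ℂ) y) ^ 2
      = ‖a‖ₑ ^ 2 * ENNReal.ofReal (l2local Ω c ψ y) ^ 2 := by
    intro c y
    rw [← mul_pow, ← ofReal_norm, ← ENNReal.ofReal_mul (norm_nonneg a)]
    congr 2
    simp [l2local]
    ring
  rw [l2norm_eq, l2norm_eq]
  simp only [h]
  simp_rw [lintegral_const_mul' (‖a‖ₑ ^ 2) _ (by simp), ENNReal.tsum_mul_left]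
  rw [ENNReal.mul_rpow_of_nonneg _ _ (by norm_num), ← ENNReal.rpow_natCast, ← ENNReal.rpow_mul]
  simp

/-- Local finiteness of the partition leaves finitely many charts meeting the support of ψ. In each,
the integrand lives on the image K of a compact subset of the chart domain, where it is continuous.
-/
theorem l2norm_ne_top {ψ : L.Sec k} (hψ : HasCompactSupport (ψ : M → ℂ)) : l2norm Ω ψ ≠ ⊤ := by
  rw [l2norm_eq]
  refine ENNReal.rpow_ne_top_of_nonneg (by norm_num) ?_
  have hfin := (chartPartition n M).locallyFinite.finite_nonempty_inter_compact hψ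
  rw [tsum_eq_sum (s := hfin.toFinset)]
  · refine ENNReal.sum_ne_top.2 fun c _ => ?_
    set e := chartAt (Rn n) c
    have hsub : tsupport (ψ : M → ℂ) ∩ tsupport (chartPartition n M c) ⊆ e.source := fun x hx =>
      chartPartition_isSubordinate c hx.2
    set K := e '' (tsupport (ψ : M → ℂ) ∩ tsupport (chartPartition n M c))
    have hK : IsCompact K := (hψ.isCompact.inter_right (isClosed_tsupport _)).image_of_continuousOn
      (e.continuousOn.mono hsub)
    have hKt : K ⊆ e.target := by
      rintro _ ⟨x, hx, rfl⟩
      exact e.map_source (hsub hx)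
    have hi : IntegrableOn (fun y => l2local Ω c ψ y ^ 2) K :=
      (((continuousOn_l2local c ψ).mono hKt).pow 2).integrableOn_compact hK
    refine ne_top_of_le_ne_top hi.lintegral_lt_top.ne ?_
    rw [← lintegral_indicator e.open_target.measurableSet,
      ← lintegral_indicator hK.measurableSet]
    refine lintegral_mono fun y => ?_
    by_cases hy : y ∈ K
    · rw [indicator_of_mem hy, indicator_of_mem (hKt hy),
        ENNReal.ofReal_pow (l2local_nonneg Ω c ψ y)]
    · by_cases ht : y ∈ e.target
      -- A nonzero value would make both ψ and the partition function nonzero at the corresponding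
      -- point, which puts y in K.
      · have : l2local Ω c ψ y = 0 := by
          by_contra hne
          refine hy ⟨e.symm y, ⟨subset_tsupport _ fun h0 => hne ?_,
            subset_tsupport _ fun h0 => hne ?_⟩, e.right_inv ht⟩
          · simp only [l2local]
            rw [h0]; simp
          · simp only [l2local]
            rw [h0]; simp
        simp [indicator_of_mem ht, this]
      · simp [indicator_of_notMem ht]
  · intro c hc
    refine lintegral_eq_zero_of_ae_eq_zero (Filter.Eventually.of_forall fun y => ?_)
    have : l2local Ω c ψ y = 0 := by
      by_contra hne
      refine hc (hfin.mem_toFinset.2 ⟨(chartAt (Rn n) c).symm y, fun h0 => hne ?_,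
        subset_tsupport _ fun h0 => hne ?_⟩)
      · simp only [l2local]
        rw [h0]; simp
      · simp only [l2local]
        rw [h0]; simp
    simp [this]

/-- At a point where ψ ≠ 0 some partition function is positive, and so is the density. By continuity
the local integrand is then nonzero on a nonempty open set, which has positive Lebesgue measure. -/
theorem eq_zero_of_l2norm_eq_zero {ψ : L.Sec k} (h : l2norm Ω ψ = 0) : ψ = 0 := by
  ext x
  by_contra hx
  change ψ.1 x ≠ 0 at hx
  obtain ⟨c, hc⟩ := (chartPartition n M).exists_pos_of_mem (mem_univ x)
  have hxs : x ∈ (chartAt (Rn n) c).source :=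
    chartPartition_isSubordinate c (subset_tsupport _ hc.ne')
  set e := chartAt (Rn n) c
  rw [l2norm_eq, ENNReal.rpow_eq_zero_iff_of_pos (by norm_num), ENNReal.tsum_eq_zero] at h
  have h0 := (lintegral_eq_zero_iff' ((aemeasurable_l2local c ψ).pow_const 2)).1 (h c)
  have hopen : IsOpen (e.target ∩ l2local Ω c ψ ⁻¹' {0}ᶜ) :=
    (continuousOn_l2local c ψ).isOpen_inter_preimage e.open_target isOpen_compl_singleton
  have hmem : e x ∈ e.target ∩ l2local Ω c ψ ⁻¹' {0}ᶜ := by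
    refine ⟨e.map_source hxs, ?_⟩
    change l2local Ω c ψ (e x) ≠ 0
    simp only [l2local]
    rw [e.left_inv hxs]
    have := liouvilleDensity_pos Ω hxs
    have h3 := norm_pos_iff.2 hx
    positivity
  refine (hopen.measure_pos volume ⟨_, hmem⟩).ne' ?_
  rw [Filter.EventuallyEq, ae_restrict_iff' e.open_target.measurableSet, ae_iff] at h0
  refine measure_mono_null (fun y hy => ?_) h0
  simp only [mem_ofPred_eq, Classical.not_imp]
  refine ⟨hy.1, fun h1 => hy.2 ?_⟩
  have h2 : ENNReal.ofReal (l2local Ω c ψ y) = 0 := by simpa using h1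
  exact le_antisymm (ENNReal.ofReal_eq_zero.1 h2) (l2local_nonneg Ω c ψ y)

theorem isExtSeminorm_l2norm_apply (ψ : L.Sec k) :
    IsExtSeminorm fun A : L.Op k => l2norm Ω (A ψ : L.Sec k) where
  add_le A B := l2norm_add_le (A ψ) (B ψ)
  smul c A := l2norm_smul c (A ψ)

end Norm

/-! ### The main theorem -/

theorem mainTheorem7 {n : ℕ} {M : Type*} [TopologicalSpace M] [ChartedSpace (Rn n) M]
    [IsManifold (𝓡 n) ∞ M] [T2Space M] [SigmaCompactSpace M]
    {ET T : Type*} [NormedAddCommGroup ET] [NormedSpace ℂ ET] [TopologicalSpace T]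
    [ChartedSpace ET T] [IsManifold 𝓘(ℂ, ET) ∞ T]
    {ι : Type*} {Ω : SymplecticForm n M} (L : PrequantumBundle ι Ω)
    (H : HitchinWittenData ET T Ω) (k : ℕ) (hk : 0 < k)
    (S : ℕ → L.OpFamily k ET T)
    (l : Filter ℝ) [l.NeBot] (hl : l ≤ Bornology.cobounded ℝ) :
    ((∀ ψ : L.Sec k, HasCompactSupport (ψ : M → ℂ) →
        H.AsymptoticallyConstant S l (fun _ A => l2norm Ω (A ψ : L.Sec k))) ↔
      H.FormallyConstant S) ∧
    ∀ (α : Type*) (p : α → T → L.Op k → ENNReal),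
      (∀ j σ, IsExtSeminorm (p j σ)) →
      (∀ σ A, (∀ j, p j σ A = 0) → A = 0) →
      (∀ j σ (V : TangentSpace 𝓘(ℝ, ET) σ) m, p j σ (H.nablaF (S m) σ V) ≠ ⊤ ∧
        p j σ ⁅H.b L k σ V, (S m).1 σ⁆ ≠ ⊤ ∧ p j σ ⁅H.bbar L k σ V, (S m).1 σ⁆ ≠ ⊤) →
      ((∀ j, H.AsymptoticallyConstant S l (p j)) ↔ H.FormallyConstant S) := by
  refine ⟨?_, fun α p hp hsep hfin =>
    H.forall_asymptoticallyConstant_iff hk S hl hp hfin fun σ V m h => hsep σ _ h⟩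
  -- Strong L² convergence is the case of the family of seminorms indexed by compactly supported
  -- sections; for compact M these are all sections.
  have key := H.forall_asymptoticallyConstant_iff hk S hl
    (α := {ψ : L.Sec k // HasCompactSupport (ψ : M → ℂ)})
    (p := fun ψ _ A => l2norm Ω (A ψ.1 : L.Sec k))
    (fun ψ _ => isExtSeminorm_l2norm_apply ψ.1)
    (fun ψ σ V m =>
      ⟨l2norm_ne_top ((H.isLocal_nablaF (S m) σ V).hasCompactSupport ψ.2),
        l2norm_ne_top (((H.isLocal_b L k σ V).lie
          (PrequantumBundle.OpFamily.isLocal (S m) σ)).hasCompactSupport ψ.2),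
        l2norm_ne_top (((H.isLocal_bbar L k σ V).lie
          (PrequantumBundle.OpFamily.isLocal (S m) σ)).hasCompactSupport ψ.2)⟩)
    -- Separation is available only for local operators, which is enough since it is needed only for
    -- the coefficients of the formal derivative.
    (fun σ V m h => (H.isLocal_coeff_formalDeriv S σ V m).eq_zero fun ψ hψ =>
      eq_zero_of_l2norm_eq_zero (h ⟨ψ, hψ⟩))
  rw [← key]
  exact ⟨fun h ψ => h ψ.1 ψ.2, fun h ψ hψ => h ⟨ψ, hψ⟩⟩
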